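/- For $x>0$ let $\lceil x\rceil^{\mathfrak p}$ denote the smallest prime $\ge x$. For a Dirichlet character $\chi$ mod $N$ let $\tau(\chi)=\sum_{b=1}^{N}\chi(b)e^{2\pi i b/N}$ be its Gauss sum, and let $\chi_0$ be the principal character mod $N$. Let $\mathcal D_{\pm}(N)$ be the set of primitive Dirichlet characters $\chi$ mod $N$ with $\chi(-1)=\pm1$, and $\mathcal I_{\pm}(N)$ the set of imprimitive Dirichlet characters $\chi\ne\chi_0$ mod $N$ with $\chi(-1)=\pm1$. For real $c>1$, $y>0$ and $X>0$ put $$Q_{\pm}(y,X,c)=\frac1X\sum_{\substack{N\in[X,cX]\\ N\not\equiv 2\bmod 4}}\ \sum_{\chi\in\mathcal D_{\pm}(N)}\frac{\chi(\lceil yX\rceil^{\mathfrak p})}{\tau(\chi)},\qquad E_{\pm}(y,X,c)=\frac1X\sum_{\substack{N\in[X,cX]\\ N\not\equiv 2\bmod 4}}\frac1N\sum_{\chi\in\mathcal I_{\pm}(N)}\tau(\overline{\chi})\,\chi(\lceil yX\rceil^{\mathfrak p}),$$ where $N$ runs over integers, and $$T_{\pm}(y,X,c)=Q_{\pm}(y,X,c)\pm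 E_{\pm}(y,X,c).$$ Then for all real $c>1$ and $y>0$, as $X\to\infty$ through the real numbers, $$\lim_{X\to\infty}T_{+}(y,X,c)=\frac{5}{\pi^2}\int_1^c\cos\left(\frac{2\pi y}{x}\right)dx,\qquad \lim_{X\to\infty}T_{-}(y,X,c)=-i\,\frac{5}{\pi^2}\int_1^c\sin\left(\frac{2\pi y}{x}\right)dx.$$ -/

import Mathlib

namespace Murmuration

/-- The smallest prime `p` with `x ≤ p`. -/
noncomputable def primeCeil (x : ℝ) : ℕ :=
  sInf {p : ℕ | p.Prime ∧ x ≤ (p : ℝ)}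

/-- The infimum defining `primeCeil` is attained. -/
theorem primeCeil_spec (x : ℝ) : (primeCeil x).Prime ∧ x ≤ (primeCeil x : ℝ) := by
  obtain ⟨p, hp, hpp⟩ := Nat.exists_infinite_primes ⌈x⌉₊
  exact Nat.sInf_mem (s := {p : ℕ | p.Prime ∧ x ≤ (p : ℝ)}) ⟨p, hpp, Nat.ceil_le.mp hp⟩

/-- The Gauss sum `τ(χ) = ∑_{b=1}^N χ(b) e^{2πib/N}` of a Dirichlet character mod `N`. -/
noncomputable def tau {N : ℕ} (χ : DirichletCharacter ℂ N) : ℂ :=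
  ∑ b ∈ Finset.Icc 1 N,
    χ (b : ZMod N) * Complex.exp (2 * Real.pi * Complex.I * (b : ℂ) / (N : ℂ))

/-- For `N ≥ 1`, `tau` is Mathlib's Gauss sum for the standard additive character. -/
theorem tau_eq_gaussSum {N : ℕ} [NeZero N] (χ : DirichletCharacter ℂ N) :
    tau χ = gaussSum χ ZMod.stdAddChar := by
  have hN : 0 < N := Nat.pos_of_ne_zero (NeZero.ne N)
  unfold tau gaussSum
  refine Finset.sum_bij (fun b _ => (b : ZMod N)) (fun _ _ => Finset.mem_univ _) ?_ ?_ ?_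
  · intro a ha b hb h
    rw [Finset.mem_Icc] at ha hb
    have h' : a ≡ b [MOD N] := (ZMod.natCast_eq_natCast_iff a b N).mp h
    rcases lt_or_eq_of_le ha.2 with h1 | h1 <;> rcases lt_or_eq_of_le hb.2 with h2 | h2
    · exact Nat.ModEq.eq_of_lt_of_lt h' h1 h2
    · simp [Nat.ModEq, h2, Nat.mod_eq_of_lt h1] at h'; omega
    · simp [Nat.ModEq, h1, Nat.mod_eq_of_lt h2] at h'; omega
    · omega
  · intro z _
    by_cases hz : z = 0
    · exact ⟨N, Finset.mem_Icc.mpr ⟨hN, le_rfl⟩, by simp [hz]⟩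
    · refine ⟨z.val, Finset.mem_Icc.mpr ⟨?_, (ZMod.val_lt z).le⟩, by simp⟩
      exact Nat.pos_of_ne_zero (fun h => hz ((ZMod.val_eq_zero z).mp h))
  · intro b _
    rw [ZMod.stdAddChar_apply, ZMod.toCircle_natCast]

/-- The primitive Dirichlet characters `χ` mod `N` with `χ(-1) = ε`; here `ε = 1` gives the even
and `ε = -1` the odd ones. -/
noncomputable def primitiveChars (ε : ℤˣ) (N : ℕ) : Finset (DirichletCharacter ℂ N) :=
  open Classical in
  Finset.univ.filter fun χ => χ.IsPrimitive ∧ χ (-1) = ((ε : ℤ) : ℂ)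

/-- The imprimitive non-principal Dirichlet characters `χ` mod `N` with `χ(-1) = ε`. -/
noncomputable def imprimitiveChars (ε : ℤˣ) (N : ℕ) : Finset (DirichletCharacter ℂ N) :=
  open Classical in
  Finset.univ.filter fun χ => ¬ χ.IsPrimitive ∧ χ ≠ 1 ∧ χ (-1) = ((ε : ℤ) : ℂ)

/-- The integers `N ∈ [X, cX]` with `N ≢ 2 mod 4` (for `X > 0`). -/
noncomputable def conductors (X c : ℝ) : Finset ℕ :=
  (Finset.Icc ⌈X⌉₊ ⌊c * X⌋₊).filter fun N => ¬ N ≡ 2 [MOD 4]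

theorem mem_conductors {X c : ℝ} (hX : 0 < X) (hc : 1 < c) (N : ℕ) :
    N ∈ conductors X c ↔ (X ≤ N ∧ (N : ℝ) ≤ c * X) ∧ ¬ N ≡ 2 [MOD 4] := by
  have h : 0 ≤ c * X := by positivity
  simp [conductors, Nat.le_floor_iff h]

/-- `Q_ε(y, X, c)`, the normalized sum of `χ(⌈yX⌉^𝔭) / τ(χ)` over primitive characters. -/
noncomputable def Q (ε : ℤˣ) (y X c : ℝ) : ℂ :=
  1 / (X : ℂ) * ∑ N ∈ conductors X c, ∑ χ ∈ primitiveChars ε N,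
    χ (primeCeil (y * X) : ZMod N) / tau χ

/-- `E_ε(y, X, c)`, the contribution of the imprimitive characters; `star χ` is the complex
conjugate character. -/
noncomputable def E (ε : ℤˣ) (y X c : ℝ) : ℂ :=
  1 / (X : ℂ) * ∑ N ∈ conductors X c, 1 / (N : ℂ) * ∑ χ ∈ imprimitiveChars ε N,
    tau (star χ) * χ (primeCeil (y * X) : ZMod N)

/-- `T_±(y, X, c) = Q_±(y, X, c) ± E_±(y, X, c)`. -/
noncomputable def T (ε : ℤˣ) (y X c : ℝ) : ℂ :=
  Q ε y X c + ((ε : ℤ) : ℂ) * E ε y X c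

end Murmuration

/-! For primitive `χ` of parity `ε`, `τ(χ)τ(χ⁻¹) = εN` turns `χ(p)/τ(χ)` into `(ε/N) τ(χ⁻¹)χ(p)`,
which is exactly the shape of the imprimitive terms in `E`. So `T` sums one expression over all
characters of parity `ε`, except for an imprimitive principal character, whose Gauss sum is at most
`√N`. When `p ∤ N`, orthogonality evaluates the full sum: each modulus contributes `φ(N)/N ·
cos(2πp/N)` or `-i φ(N)/N · sin(2πp/N)` (`norm_modulusTerm_sub_mainTerm_le`, `mainTerm_one`,
`mainTerm_neg_one`). The errors are negligible on average (`tendsto_T_sub_mainTerm`).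

Two facts then give the limit. First, `primeCeil (y * X) / X → y`. This needs a prime in `[x, ρx]`
for every `ρ > 1` and large `x`. It comes from a Wiener–Ikehara argument with the Fejér kernel,
resting on the continuity of `-ζ'/ζ(s) - 1/(s-1)` up to `Re s = 1` (`tendsto_tsum_fejer`,
`eventually_exists_prime_log`). Second, `φ(N)/N` restricted to `N ≢ 2 mod 4` has mean value `5/π²`
(`tendsto_sum_totientWeight`), and Abel summation transfers this to smooth weights
(`tendsto_weighted_mean`), producing the integrals. -/

namespace Murmuration
open MeasureTheory Filter Topology Complex

/-! ### The Fejér kernel. -/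

/-- The Fejér kernel on the real line, as the cosine transform of the triangle function. -/
noncomputable def fejer (u : ℝ) : ℝ := ∫ t in (0 : ℝ)..1, 2 * (1 - t) * Real.cos (t * u)

theorem fejer_eq {u : ℝ} (hu : u ≠ 0) : fejer u = 2 * (1 - Real.cos u) / u ^ 2 := by
  have h : ∀ t ∈ Set.uIcc (0 : ℝ) 1, HasDerivAt
      (fun t : ℝ => 2 * (1 - t) * Real.sin (t * u) / u - 2 * Real.cos (t * u) / u ^ 2)
      (2 * (1 - t) * Real.cos (t * u)) t := by
    intro t _
    have h0 : HasDerivAt (fun t : ℝ => t * u) u t := by simpa using (hasDerivAt_id t).mul_const u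
    have h1 : HasDerivAt (fun t : ℝ => 2 * (1 - t)) (-2) t := by
      simpa using ((hasDerivAt_id t).const_sub 1).const_mul 2
    have h2 := ((h1.mul h0.sin).div_const u).sub ((h0.cos.const_mul 2).div_const (u ^ 2))
    refine h2.congr_deriv ?_
    field_simp
    ring
  unfold fejer
  rw [intervalIntegral.integral_eq_sub_of_hasDerivAt h (by
    apply Continuous.intervalIntegrable; fun_prop)]
  simp
  ring

theorem fejer_zero : fejer 0 = 1 := by
  unfold fejer
  have h : ∀ t ∈ Set.uIcc (0 : ℝ) 1, HasDerivAt (fun t : ℝ => 2 * t - t ^ 2)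
      (2 * (1 - t) * Real.cos (t * 0)) t := by
    intro t _
    refine (((hasDerivAt_id t).const_mul 2).sub (hasDerivAt_pow 2 t)).congr_deriv ?_
    simp
    ring
  rw [intervalIntegral.integral_eq_sub_of_hasDerivAt h (by
    apply Continuous.intervalIntegrable; fun_prop)]
  norm_num

theorem fejer_nonneg (u : ℝ) : 0 ≤ fejer u := by
  rcases eq_or_ne u 0 with rfl | hu
  · simp [fejer_zero]
  · rw [fejer_eq hu]
    have := Real.cos_le_one u
    exact div_nonneg (by linarith) (sq_nonneg u)

theorem fejer_le_one (u : ℝ) : fejer u ≤ 1 := by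
  rw [← fejer_zero]
  unfold fejer
  refine intervalIntegral.integral_mono_on zero_le_one
    (Continuous.intervalIntegrable (by fun_prop) _ _)
    (Continuous.intervalIntegrable (by fun_prop) _ _) fun t ht => ?_
  have := Real.cos_le_one (t * u)
  simp only [mul_zero, Real.cos_zero]
  exact mul_le_mul_of_nonneg_left this (by linarith [ht.2])

theorem fejer_mul_sq_le (u : ℝ) : fejer u * u ^ 2 ≤ 4 := by
  rcases eq_or_ne u 0 with rfl | hu
  · simp
  · rw [fejer_eq hu, div_mul_cancel₀ _ (by positivity)]
    linarith [Real.neg_one_le_cos u]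

theorem continuous_fejer : Continuous fejer := by
  unfold fejer
  exact intervalIntegral.continuous_parametric_intervalIntegral_of_continuous' (by fun_prop) _ _

theorem integrable_fejer : Integrable fejer := by
  refine (integrable_inv_one_add_sq.const_mul 5).mono' continuous_fejer.aestronglyMeasurable
    (Eventually.of_forall fun u => ?_)
  rw [Real.norm_of_nonneg (fejer_nonneg u), ← div_eq_mul_inv, le_div_iff₀ (by positivity)]
  linarith [fejer_mul_sq_le u, fejer_le_one u]

theorem integral_fejer_pos : 0 < ∫ u, fejer u := by
  refine integral_pos_of_integrable_nonneg_nonzero (x := 0) continuous_fejer integrable_fejer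
    fejer_nonneg ?_
  simp [fejer_zero]

/-- The Fejér kernel as the Fourier transform of the triangle function. -/
theorem ofReal_fejer (u : ℝ) :
    (fejer u : ℂ) = ∫ t in (-1 : ℝ)..1, ((1 - |t| : ℝ) : ℂ) * cexp (-(t * u * I)) := by
  have hc : Continuous fun t : ℝ => ((1 - |t| : ℝ) : ℂ) * cexp (-(t * u * I)) := by fun_prop
  rw [← intervalIntegral.integral_add_adjacent_intervals (hc.intervalIntegrable (-1) 0)
    (hc.intervalIntegrable 0 1)]
  have h1 := intervalIntegral.integral_comp_neg (a := 0) (b := 1)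
    (fun t : ℝ => ((1 - |t| : ℝ) : ℂ) * cexp (-(t * u * I)))
  rw [neg_zero] at h1
  rw [← h1, ← intervalIntegral.integral_add
    (Continuous.intervalIntegrable (by fun_prop) _ _) (hc.intervalIntegrable _ _), fejer,
    ← intervalIntegral.integral_ofReal]
  refine intervalIntegral.integral_congr fun t ht => ?_
  rw [Set.uIcc_of_le zero_le_one] at ht
  simp only [abs_neg, abs_of_nonneg ht.1]
  push_cast
  rw [Complex.cos]
  rw [show (-(-(t : ℂ) * u * I)) = t * u * I by ring,
    show (-((t : ℂ) * u * I)) = -(t * u) * I by ring]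
  ring

/-- The kernel vanishes at nonzero multiples of `2π`, so it cannot alone dominate `u⁻²`. Its zeros
and those of its translate by `1` are uniformly separated, so the sum can. This bounds the tails of
a narrow kernel by kernels of unit width. -/
theorem inv_sq_le_fejer {δ : ℝ} (hδ : 0 < δ) : ∃ C : ℝ, 0 < C ∧ ∀ u : ℝ, δ ≤ |u| →
    4 / u ^ 2 ≤ C * (fejer u + fejer (u + 1)) := by
  have hc1 : Real.cos (1 / 2) < 1 := by
    simpa using Real.cos_lt_cos_of_nonneg_of_le_pi_div_two le_rfl
      (by linarith [Real.pi_gt_three] : (1 / 2 : ℝ) ≤ Real.pi / 2) (by norm_num)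
  have hc0 : 0 ≤ Real.cos (1 / 2) := Real.cos_nonneg_of_neg_pi_div_two_le_of_le
    (by linarith [Real.pi_gt_three]) (by linarith [Real.pi_gt_three])
  set κ := 1 - Real.cos (1 / 2) with hκ
  have hκ0 : 0 < κ := by linarith
  refine ⟨(1 + 1 / δ) ^ 2 / κ, by positivity, fun u hu => ?_⟩
  have hu0 : u ≠ 0 := fun h => by rw [h, abs_zero] at hu; linarith
  have hM : 1 ≤ 1 + 1 / δ := by have := one_div_pos.mpr hδ; linarith
  -- Chosen so that `|u + 1| ≤ M |u|` whenever `|u| ≥ δ`.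
  set M := 1 + 1 / δ with hMdef
  have hMu : (u + 1) ^ 2 ≤ M ^ 2 * u ^ 2 := by
    rw [← mul_pow, sq_le_sq, abs_mul, abs_of_pos (by linarith : 0 < M)]
    calc |u + 1| ≤ |u| + |1| := abs_add_le _ _
      _ = |u| + 1 / δ * δ := by rw [abs_one]; field_simp
      _ ≤ |u| + 1 / δ * |u| := by gcongr
      _ = M * |u| := by rw [hMdef]; ring
  have hu2 : 0 < u ^ 2 := by positivity
  have h1 : 2 * (1 - Real.cos u) ≤ M ^ 2 * u ^ 2 * fejer u := by
    rw [fejer_eq hu0]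
    have := Real.cos_le_one u
    have h3 : M ^ 2 * u ^ 2 * (2 * (1 - Real.cos u) / u ^ 2) = M ^ 2 * (2 * (1 - Real.cos u)) := by
      field_simp
    rw [h3]
    exact le_mul_of_one_le_left (by linarith) (one_le_pow₀ hM)
  have h2 : 2 * (1 - Real.cos (u + 1)) ≤ M ^ 2 * u ^ 2 * fejer (u + 1) := by
    rcases eq_or_ne (u + 1) 0 with h0 | h0
    · rw [h0]
      simp only [Real.cos_zero, sub_self, mul_zero]
      exact mul_nonneg (by positivity) (fejer_nonneg 0)
    · calc 2 * (1 - Real.cos (u + 1)) = (u + 1) ^ 2 * fejer (u + 1) := by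
            rw [fejer_eq h0]; field_simp
        _ ≤ _ := mul_le_mul_of_nonneg_right hMu (fejer_nonneg _)
  -- The two cosines cannot both be near `1`: their sum is `2 cos(u + 1/2) cos(1/2)`.
  have h3 : 4 * κ ≤ 2 * (1 - Real.cos u) + 2 * (1 - Real.cos (u + 1)) := by
    have : Real.cos u + Real.cos (u + 1) = 2 * Real.cos (u + 1 / 2) * Real.cos (1 / 2) := by
      rw [Real.cos_add_cos, ← Real.cos_neg ((u - (u + 1)) / 2)]
      ring_nf
    have h5 := Real.cos_le_one (u + 1 / 2)
    rw [hκ]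
    nlinarith
  rw [div_le_iff₀ hu2]
  calc (4 : ℝ) = 4 * κ / κ := by field_simp
    _ ≤ (M ^ 2 * u ^ 2 * fejer u + M ^ 2 * u ^ 2 * fejer (u + 1)) / κ := by
        gcongr; linarith
    _ = _ := by ring

end Murmuration

/-! ### Fejér-weighted Dirichlet series to the right of `Re s = 1`. -/

namespace Murmuration
open MeasureTheory Filter Topology Complex

/-- The polar part of a Dirichlet series integrated against the triangle function. -/
theorem integral_triangle_mul_inv {η : ℝ} (hη : 0 < η) (R w : ℝ) :
    ∫ t in (-1 : ℝ)..1, ((1 - |t| : ℝ) : ℂ) * cexp (t * (R * w) * I) * (1 / (η + t * R * I)) =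
      ((∫ v in Set.Ioi (0 : ℝ), Real.exp (-η * v) * fejer (R * (v - w)) : ℝ) : ℂ) := by
  -- The pole term is a Laplace integral in `v`. After Fubini the `t`-integral is a value of the
  -- Fejér kernel.
  have hinner (t : ℝ) : 1 / ((η : ℂ) + t * R * I) =
      ∫ v in Set.Ioi (0 : ℝ), cexp (-(η + t * R * I) * v) := by
    rw [integral_exp_mul_complex_Ioi (by simpa using hη)]
    rw [ofReal_zero, mul_zero, Complex.exp_zero, neg_div_neg_eq]
  simp_rw [hinner, ← integral_const_mul]
  rw [intervalIntegral.integral_of_le (by norm_num), integral_integral_swap,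
    ← integral_complex_ofReal]
  · refine integral_congr_ae (Eventually.of_forall fun v => ?_)
    simp only []
    rw [ofReal_mul, ofReal_fejer, ← intervalIntegral.integral_const_mul,
      intervalIntegral.integral_of_le (by norm_num)]
    refine integral_congr_ae (Eventually.of_forall fun t => ?_)
    simp only []
    rw [ofReal_exp, mul_assoc, ← Complex.exp_add,
      mul_left_comm (cexp ((-η * v : ℝ) : ℂ)), ← Complex.exp_add]
    congr 2
    push_cast
    ring
  · have h1 : Integrable (fun _ : ℝ => (1 : ℝ)) (volume.restrict (Set.Ioc (-1 : ℝ) 1)) :=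
      integrable_const _
    have h2 : Integrable (fun v : ℝ => Real.exp (-η * v)) (volume.restrict (Set.Ioi (0 : ℝ))) :=
      integrableOn_exp_mul_Ioi (by linarith) 0
    refine (h1.mul_prod h2).mono' (Continuous.aestronglyMeasurable (by fun_prop)) ?_
    rw [Measure.prod_restrict]
    refine (ae_restrict_mem (measurableSet_Ioc.prod measurableSet_Ioi)).mono fun z hz => ?_
    simp only [Function.uncurry, norm_mul, Complex.norm_exp, one_mul]
    have ht : |z.1| ≤ 1 := abs_le.mpr ⟨hz.1.1.le, hz.1.2⟩
    have e1 : ((z.1 : ℂ) * (R * w) * I).re = 0 := by simp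
    have e2 : (-((η : ℂ) + z.1 * R * I) * z.2).re = -η * z.2 := by simp
    rw [e1, e2, Real.exp_zero, mul_one, norm_real, Real.norm_of_nonneg (by linarith)]
    exact mul_le_of_le_one_left (Real.exp_pos _).le (by linarith [abs_nonneg z.1])

/-- Parseval-type identity for a Dirichlet series with nonnegative coefficients. -/
theorem hasSum_fejer {a : ℕ → ℝ} (ha0 : a 0 = 0) (hnn : ∀ n, 0 ≤ a n) {σ : ℝ}
    (hs : Summable fun n : ℕ => a n / (n : ℝ) ^ σ) (R w : ℝ) :
    HasSum (fun n : ℕ => ((a n / (n : ℝ) ^ σ * fejer (R * (Real.log n - w)) : ℝ) : ℂ))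
      (∫ t in (-1 : ℝ)..1, ((1 - |t| : ℝ) : ℂ) * cexp (t * (R * w) * I) *
        LSeries (fun n => (a n : ℂ)) (σ + t * R * I)) := by
  have hterm (n : ℕ) (t : ℝ) : LSeries.term (fun n => (a n : ℂ)) (σ + t * R * I) n =
      ((a n / (n : ℝ) ^ σ : ℝ) : ℂ) * cexp (-(t * (R * Real.log n) * I)) := by
    rcases eq_or_ne n 0 with rfl | hn
    · simp [ha0]
    · have hn0 : (n : ℂ) ≠ 0 := Nat.cast_ne_zero.mpr hn
      rw [LSeries.term_of_ne_zero hn, Complex.cpow_add _ _ hn0, ofReal_div,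
        ofReal_cpow (Nat.cast_nonneg n), ofReal_natCast, Complex.exp_neg,
        Complex.cpow_def_of_ne_zero hn0 (t * R * I), natCast_log]
      rw [div_mul_eq_div_div, div_eq_mul_inv _ (cexp _)]
      congr 3
      ring
  have key := intervalIntegral.hasSum_integral_of_dominated_convergence (μ := volume)
    (a := -1) (b := 1) (F := fun (n : ℕ) (t : ℝ) => ((1 - |t| : ℝ) : ℂ) * cexp (t * (R * w) * I) *
      LSeries.term (fun n => (a n : ℂ)) (σ + t * R * I) n)
    (f := fun t => ((1 - |t| : ℝ) : ℂ) * cexp (t * (R * w) * I) *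
        LSeries (fun n => (a n : ℂ)) (σ + t * R * I))
    (fun n _ => a n / (n : ℝ) ^ σ) ?_ ?_ ?_ ?_ ?_
  · convert! key using 2 with n
    simp only [hterm]
    rw [ofReal_mul, ofReal_fejer, ← intervalIntegral.integral_const_mul]
    refine intervalIntegral.integral_congr fun t _ => ?_
    rw [mul_assoc (((1 - |t| : ℝ) : ℂ)), mul_left_comm (cexp _), ← Complex.exp_add, mul_left_comm]
    congr 3
    push_cast
    ring
  · intro n
    simp only [hterm]
    exact Continuous.aestronglyMeasurable (by fun_prop)
  · intro n
    refine Eventually.of_forall fun t ht => ?_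
    rw [Set.uIoc_of_le (by norm_num)] at ht
    have ht' : |t| ≤ 1 := abs_le.mpr ⟨ht.1.le, ht.2⟩
    have h0 : 0 ≤ a n / (n : ℝ) ^ σ := div_nonneg (hnn n) (by positivity)
    rw [hterm, norm_mul, norm_mul, norm_mul, Complex.norm_exp, Complex.norm_exp, norm_real,
      norm_real, Real.norm_of_nonneg h0, Real.norm_of_nonneg (by linarith)]
    have e1 : ((t : ℂ) * (R * w) * I).re = 0 := by simp
    have e2 : (-((t : ℂ) * (R * Real.log n) * I)).re = 0 := by simp [-natCast_log]
    rw [e1, e2, Real.exp_zero, mul_one, mul_one]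
    exact mul_le_of_le_one_left h0 (by linarith [abs_nonneg t])
  · exact Eventually.of_forall fun t _ => hs
  · simp
  · refine Eventually.of_forall fun t _ => HasSum.mul_left _ ?_
    have : Summable (LSeries.term (fun n => (a n : ℂ)) (σ + t * R * I)) := by
      refine Summable.of_norm (hs.congr fun n => ?_)
      have h0 : 0 ≤ a n / (n : ℝ) ^ σ := div_nonneg (hnn n) (by positivity)
      rw [hterm, norm_mul, Complex.norm_exp, norm_real, Real.norm_of_nonneg h0]
      have e2 : (-((t : ℂ) * (R * Real.log n) * I)).re = 0 := by simp [-natCast_log]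
      rw [e2, Real.exp_zero, mul_one]
    exact this.hasSum

end Murmuration

/-! ### Passage to the line `Re s = 1` and the smoothed prime number theorem. -/

namespace Murmuration
open MeasureTheory Filter Topology Complex

theorem integrable_fejer_comp {R : ℝ} (hR : 0 < R) (w : ℝ) :
    Integrable fun v => fejer (R * (v - w)) :=
  (integrable_fejer.comp_mul_left' hR.ne').comp_sub_right w

theorem integral_fejer_comp {R : ℝ} (hR : 0 < R) :
    ∫ v, fejer (R * v) = (∫ v, fejer v) / R := by
  rw [Measure.integral_comp_mul_left, abs_of_pos (inv_pos.mpr hR), smul_eq_mul, inv_mul_eq_div]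

/-- The `max` keeps the argument in the closed half-plane for every real first coordinate, so
continuity is global and parametric integrals need no one-sided version. -/
theorem continuous_boundary {G : ℂ → ℂ} (hGc : ContinuousOn G {s | 1 ≤ s.re}) (R : ℝ) :
    Continuous fun z : ℝ × ℝ => G (1 + (max z.1 0 : ℝ) + z.2 * R * I) := by
  refine hGc.comp_continuous (by fun_prop) fun z => ?_
  simp

/-- The boundary value at `s = 1` of a weighted Dirichlet series with nonnegative coefficients and
a simple pole at `s = 1`. -/
theorem hasSum_fejer_one {a : ℕ → ℝ} (ha0 : a 0 = 0) (hnn : ∀ n, 0 ≤ a n)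
    (hs : ∀ σ : ℝ, 1 < σ → Summable fun n : ℕ => a n / (n : ℝ) ^ σ) {G : ℂ → ℂ}
    (hGc : ContinuousOn G {s | 1 ≤ s.re})
    (hG : ∀ s : ℂ, 1 < s.re → G s = LSeries (fun n => (a n : ℂ)) s - 1 / (s - 1))
    {R : ℝ} (hR : 0 < R) (w : ℝ) :
    HasSum (fun n : ℕ => a n / n * fejer (R * (Real.log n - w)))
      ((∫ t in (-1 : ℝ)..1, ((1 - |t| : ℝ) : ℂ) * cexp (t * (R * w) * I) *
          G (1 + t * R * I)).re + ∫ v in Set.Ioi (0 : ℝ), fejer (R * (v - w))) := by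
  set A : ℝ → ℂ := fun η => ∫ t in (-1 : ℝ)..1, ((1 - |t| : ℝ) : ℂ) * cexp (t * (R * w) * I) *
          G (1 + (max η 0 : ℝ) + t * R * I) with hA
  set B : ℝ → ℝ := fun η => ∫ v in Set.Ioi (0 : ℝ), Real.exp (-η * v) * fejer (R * (v - w)) with hB
  have hA0 : A 0 = ∫ t in (-1 : ℝ)..1, ((1 - |t| : ℝ) : ℂ) * cexp (t * (R * w) * I) *
          G (1 + t * R * I) := by simp [hA]
  have hB0 : B 0 = ∫ v in Set.Ioi (0 : ℝ), fejer (R * (v - w)) := by simp [hB]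
  have hAc : Continuous A := by
    refine intervalIntegral.continuous_parametric_intervalIntegral_of_continuous' ?_ _ _
    exact Continuous.mul (by fun_prop) (continuous_boundary hGc R)
  have hint := (integrable_fejer_comp hR w).integrableOn (s := Set.Ioi (0 : ℝ))
  have hBt : Tendsto B (𝓝[>] 0) (𝓝 (B 0)) := by
    refine tendsto_integral_filter_of_dominated_convergence (fun v => fejer (R * (v - w)))
      ?_ ?_ hint ?_
    · refine Eventually.of_forall fun η => Continuous.aestronglyMeasurable ?_
      have := continuous_fejer
      fun_prop
    · filter_upwards [self_mem_nhdsWithin] with η hη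
      refine (ae_restrict_mem measurableSet_Ioi).mono fun v hv => ?_
      have hv' : 0 < v := hv
      have hη' : 0 < η := hη
      rw [Real.norm_of_nonneg (mul_nonneg (Real.exp_pos _).le (fejer_nonneg _))]
      refine mul_le_of_le_one_left (fejer_nonneg _) (Real.exp_le_one_iff.mpr ?_)
      nlinarith
    · refine Eventually.of_forall fun v => ?_
      have : Continuous fun η : ℝ => Real.exp (-η * v) * fejer (R * (v - w)) := by fun_prop
      exact this.continuousAt.tendsto.mono_left nhdsWithin_le_nhds
  have hlim : Tendsto (fun η => (A η).re + B η) (𝓝[>] 0) (𝓝 ((A 0).re + B 0)) :=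
    ((continuous_re.comp hAc).continuousAt.tendsto.mono_left nhdsWithin_le_nhds).add hBt
  have hsum : ∀ η > 0, HasSum (fun n : ℕ => a n / (n : ℝ) ^ (1 + η) *
      fejer (R * (Real.log n - w))) ((A η).re + B η) := by
    intro η hη
    have h := hasSum_fejer ha0 hnn (hs (1 + η) (by linarith)) R w
    have e : (∫ t in (-1 : ℝ)..1, ((1 - |t| : ℝ) : ℂ) * cexp (t * (R * w) * I) *
        LSeries (fun n => (a n : ℂ)) ((1 + η : ℝ) + t * R * I)) = A η + B η := by
      rw [hA, hB, ← integral_triangle_mul_inv hη R w, ← intervalIntegral.integral_add]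
      · refine intervalIntegral.integral_congr fun t _ => ?_
        rw [hG _ (by simpa using hη), max_eq_left hη.le]
        rw [show (1 : ℂ) + η + t * R * I - 1 = η + t * R * I by ring]
        push_cast
        ring
      · have := continuous_boundary hGc R
        have h2 : Continuous fun t : ℝ => G (1 + (max η 0 : ℝ) + t * R * I) :=
          this.comp (f := fun t : ℝ => (η, t)) (by fun_prop)
        exact Continuous.intervalIntegrable (Continuous.mul (by fun_prop) h2) _ _
      · refine Continuous.intervalIntegrable ?_ _ _
        refine Continuous.mul (by fun_prop) (continuous_const.div (by fun_prop) fun t h => ?_)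
        have := congrArg Complex.re h
        simp at this
        exact hη.ne' this
    rw [e] at h
    have h2 := Complex.hasSum_re h
    simpa only [ofReal_re, add_re] using h2
  have hnn1 (n : ℕ) : 0 ≤ a n / n * fejer (R * (Real.log n - w)) :=
    mul_nonneg (div_nonneg (hnn n) n.cast_nonneg) (fejer_nonneg _)
  have hnnη (η : ℝ) (n : ℕ) : 0 ≤ a n / (n : ℝ) ^ (1 + η) * fejer (R * (Real.log n - w)) :=
    mul_nonneg (div_nonneg (hnn n) (by positivity)) (fejer_nonneg _)
  -- Nonnegativity does the work: a finite partial sum is the limit as `η → 0⁺` of partial sums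
  -- bounded by the full sums.
  have hpart (s : Finset ℕ) : ∑ n ∈ s, a n / n * fejer (R * (Real.log n - w)) ≤
      (A 0).re + B 0 := by
    have ht : Tendsto (fun η : ℝ => ∑ n ∈ s, a n / (n : ℝ) ^ (1 + η) *
        fejer (R * (Real.log n - w))) (𝓝[>] 0)
        (𝓝 (∑ n ∈ s, a n / n * fejer (R * (Real.log n - w)))) := by
      refine tendsto_finsetSum _ fun n _ => ?_
      rcases eq_or_ne n 0 with rfl | hn
      · simp [ha0]
      · have hn' : (0 : ℝ) < n := Nat.cast_pos.mpr (Nat.pos_of_ne_zero hn)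
        have hc : ContinuousAt (fun η : ℝ => a n / (n : ℝ) ^ (1 + η) *
            fejer (R * (Real.log n - w))) 0 := by
          refine ContinuousAt.mul (ContinuousAt.div continuousAt_const ?_ (by positivity))
            continuousAt_const
          exact ContinuousAt.rpow continuousAt_const (by fun_prop) (Or.inl hn'.ne')
        have := hc.tendsto.mono_left (nhdsWithin_le_nhds (s := Set.Ioi 0))
        simpa using this
    refine le_of_tendsto_of_tendsto ht hlim ?_
    filter_upwards [self_mem_nhdsWithin] with η hη
    exact sum_le_hasSum s (fun n _ => hnnη η n) (hsum η hη)
  have hsummable := summable_of_sum_le hnn1 hpart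
  have hle := hsummable.tsum_le_of_sum_le hpart
  -- Conversely, each term at `1 + η` is at most the term at `1`.
  have hge : (A 0).re + B 0 ≤ ∑' n : ℕ, a n / n * fejer (R * (Real.log n - w)) := by
    refine le_of_tendsto hlim ?_
    filter_upwards [self_mem_nhdsWithin] with η hη
    refine hasSum_le (fun n => ?_) (hsum η hη) hsummable.hasSum
    rcases eq_or_ne n 0 with rfl | hn
    · simp [ha0]
    · have hn' : (1 : ℝ) ≤ n := Nat.one_le_cast.mpr (Nat.pos_of_ne_zero hn)
      have hη' : 0 < η := hη
      refine mul_le_mul_of_nonneg_right ?_ (fejer_nonneg _)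
      refine div_le_div_of_nonneg_left (hnn n) (by linarith) ?_
      exact Real.self_le_rpow_of_one_le hn' (by linarith)
  rw [← hA0, ← hB0, ← le_antisymm hle hge]
  exact hsummable.hasSum

/-- The Riemann–Lebesgue lemma: only the pole contributes in the limit. `G` is arbitrary because the
Bochner integral of a non-integrable function is `0`. -/
theorem tendsto_boundary_integral (G : ℂ → ℂ) {R : ℝ} (hR : 0 < R) :
    Tendsto (fun w : ℝ => (∫ t in (-1 : ℝ)..1, ((1 - |t| : ℝ) : ℂ) * cexp (t * (R * w) * I) *
          G (1 + t * R * I)).re) atTop (𝓝 0) := by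
  have h := Real.tendsto_integral_exp_smul_cocompact
    ((Set.Ioc (-1 : ℝ) 1).indicator fun t : ℝ => ((1 - |t| : ℝ) : ℂ) * G (1 + t * R * I))
  have hw : Tendsto (fun w : ℝ => -(R * w) / (2 * Real.pi)) atTop (cocompact ℝ) := by
    refine Tendsto.mono_right ?_ atBot_le_cocompact
    have : Tendsto (fun w : ℝ => (R / (2 * Real.pi)) * w) atTop atTop :=
      tendsto_id.const_mul_atTop (by positivity)
    refine (tendsto_neg_atTop_atBot.comp this).congr fun w => ?_
    simp only [Function.comp]
    ring
  have h2 := (continuous_re.tendsto 0).comp (h.comp hw)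
  rw [zero_re] at h2
  refine h2.congr fun w => ?_
  simp only [Function.comp]
  rw [intervalIntegral.integral_of_le (by norm_num), ← integral_indicator measurableSet_Ioc]
  congr 2
  ext t
  by_cases ht : t ∈ Set.Ioc (-1 : ℝ) 1
  · simp only [Set.indicator_of_mem ht, Circle.smul_def, smul_eq_mul, Real.fourierChar_apply]
    rw [mul_left_comm, ← mul_assoc]
    congr 3
    push_cast
    have : (Real.pi : ℂ) ≠ 0 := ofReal_ne_zero.mpr Real.pi_ne_zero
    field_simp
  · simp [Set.indicator_of_notMem ht]

theorem tendsto_integral_Ioi_fejer {R : ℝ} (hR : 0 < R) :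
    Tendsto (fun w : ℝ => ∫ v in Set.Ioi (0 : ℝ), fejer (R * (v - w))) atTop
      (𝓝 ((∫ v, fejer v) / R)) := by
  have hi : Integrable fun v => fejer (R * v) := integrable_fejer.comp_mul_left' hR.ne'
  have e (w : ℝ) : ∫ v in Set.Ioi (0 : ℝ), fejer (R * (v - w)) =
      ∫ v, (Set.Ioi (-w)).indicator (fun v => fejer (R * v)) v := by
    rw [← integral_indicator measurableSet_Ioi,
      ← integral_sub_right_eq_self (fun v => (Set.Ioi (-w)).indicator (fun v => fejer (R * v)) v) w]
    congr 1
    ext v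
    simp [Set.indicator_apply]
  simp_rw [e]
  rw [← integral_fejer_comp hR]
  refine tendsto_integral_filter_of_dominated_convergence (fun v => fejer (R * v))
    (Eventually.of_forall fun w => hi.aestronglyMeasurable.indicator measurableSet_Ioi) ?_ hi ?_
  · refine Eventually.of_forall fun w => Eventually.of_forall fun v => ?_
    refine (norm_indicator_le_norm_self _ _).trans_eq (Real.norm_of_nonneg (fejer_nonneg _))
  · refine Eventually.of_forall fun v => tendsto_const_nhds.congr' ?_
    filter_upwards [eventually_gt_atTop (-v)] with w hw
    rw [Set.indicator_of_mem]
    simp only [Set.mem_Ioi]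
    linarith

/-- Smoothed prime number theorem with the Fejér weight, for a Dirichlet series with nonnegative
coefficients and a simple pole at `s = 1`. -/
theorem tendsto_tsum_fejer {a : ℕ → ℝ} (ha0 : a 0 = 0) (hnn : ∀ n, 0 ≤ a n)
    (hs : ∀ σ : ℝ, 1 < σ → Summable fun n : ℕ => a n / (n : ℝ) ^ σ) {G : ℂ → ℂ}
    (hGc : ContinuousOn G {s | 1 ≤ s.re})
    (hG : ∀ s : ℂ, 1 < s.re → G s = LSeries (fun n => (a n : ℂ)) s - 1 / (s - 1))
    {R : ℝ} (hR : 0 < R) :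
    (∀ w, Summable fun n : ℕ => a n / n * fejer (R * (Real.log n - w))) ∧
    Tendsto (fun w => ∑' n : ℕ, a n / n * fejer (R * (Real.log n - w))) atTop
      (𝓝 ((∫ v, fejer v) / R)) := by
  have h := hasSum_fejer_one ha0 hnn hs hGc hG hR
  refine ⟨fun w => (h w).summable, ?_⟩
  simp_rw [fun w => (h w).tsum_eq]
  simpa using (tendsto_boundary_integral G hR).add (tendsto_integral_Ioi_fejer hR)

end Murmuration

/-! ### Primes in short multiplicative intervals. -/

namespace Murmuration
open MeasureTheory Filter Topology
-- Without a prime near `e^w`, the Fejér sum of width `1/R` at `w` consists of non-prime terms,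
-- whose tail vanishes, and of terms with `|log n - w| ≥ δ`. By `inv_sq_le_fejer` the latter are at
-- most `C/R²` times unit-width sums at `w` and `w - 1`, hence asymptotically at most `2CJ/R²`. For
-- large `R` this is less than the true limit `J/R`.
open ArithmeticFunction.vonMangoldt in
theorem eventually_exists_prime_log {δ : ℝ} (hδ : 0 < δ) :
    ∀ᶠ w : ℝ in atTop, ∃ p : ℕ, p.Prime ∧ |Real.log p - w| < δ := by
  -- Modulo `1` every integer lies in the class, so this is the full von Mangoldt function.
  set a : ℕ → ℝ := residueClass (1 : ZMod 1) with ha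
  have hnn : ∀ n, 0 ≤ a n := residueClass_nonneg _
  have hs : ∀ σ : ℝ, 1 < σ → Summable fun n : ℕ => a n / (n : ℝ) ^ σ := fun σ hσ =>
    LSeries.summable_real_of_abscissaOfAbsConv_lt <|
      (abscissaOfAbsConv_residueClass_le_one _).trans_lt <| mod_cast hσ
  have hG : ∀ s : ℂ, 1 < s.re → LFunctionResidueClassAux (1 : ZMod 1) s =
      LSeries (fun n => (a n : ℂ)) s - 1 / (s - 1) := fun s hs' => by
    simpa using eqOn_LFunctionResidueClassAux (a := (1 : ZMod 1)) isUnit_one hs'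
  have key {R : ℝ} (hR : 0 < R) := tendsto_tsum_fejer (residueClass_apply_zero _) hnn hs
    (continuousOn_LFunctionResidueClassAux (1 : ZMod 1)) hG hR
  obtain ⟨C, hC0, hC⟩ := inv_sq_le_fejer hδ
  set J := ∫ v, fejer v with hJ
  have hJ0 : 0 < J := integral_fejer_pos
  -- Makes `2CJ/R² = J/(2R)`, strictly below `J/R`.
  set R : ℝ := 4 * C with hRdef
  have hR : 0 < R := by positivity
  set b : ℕ → ℝ := fun n => (if n.Prime then 0 else a n) / n with hb
  have hbs : Summable b := summable_residueClass_non_primes_div _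
  have hbnn (n : ℕ) : 0 ≤ b n := by
    simp only [hb]
    split_ifs
    · simp
    · exact div_nonneg (hnn n) n.cast_nonneg
  have hbind (w : ℝ) (n : ℕ) : ‖if w - δ < Real.log n then b n else 0‖ ≤ b n := by
    split_ifs
    · exact (Real.norm_of_nonneg (hbnn n)).le
    · simpa using hbnn n
  have hblim : Tendsto (fun w : ℝ => ∑' n : ℕ, if w - δ < Real.log n then b n else 0) atTop
      (𝓝 0) := by
    have := tendsto_tsum_of_dominated_convergence (𝓕 := atTop)
      (f := fun (w : ℝ) (n : ℕ) => if w - δ < Real.log n then b n else 0)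
      (g := fun _ => 0) hbs (fun n => ?_) (Eventually.of_forall fun w n => hbind w n)
    · simpa using this
    · refine tendsto_const_nhds.congr' ?_
      filter_upwards [eventually_ge_atTop (Real.log n + δ)] with w hw
      rw [if_neg (by linarith)]
  obtain ⟨hsR, htR⟩ := key hR
  obtain ⟨hs1, ht1⟩ := key one_pos
  have hrhs := hblim.add ((ht1.add (ht1.comp (tendsto_atTop_add_const_right atTop (-1 : ℝ)
    tendsto_id))).const_mul (C / R ^ 2))
  have hlt : 0 + C / R ^ 2 * (J / 1 + J / 1) < J / R := by
    rw [hRdef]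
    field_simp
    linarith
  filter_upwards [hrhs.eventually_lt htR hlt] with w hw
  by_contra! hno
  refine hw.not_ge ?_
  simp only [Function.comp, id, one_mul] at hs1 ⊢
  have hS1 := (hs1 w).add (hs1 (w + -1))
  have hsb : Summable fun n : ℕ => if w - δ < Real.log n then b n else 0 :=
    Summable.of_norm_bounded hbs (hbind w)
  rw [← (hs1 w).tsum_add (hs1 (w + -1)), ← tsum_mul_left, ← hsb.tsum_add (hS1.mul_left _)]
  refine (hsR w).tsum_le_tsum (fun n => ?_) (hsb.add (hS1.mul_left _))
  have han : 0 ≤ a n / n := div_nonneg (hnn n) n.cast_nonneg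
  have hfn := fejer_nonneg (Real.log n - w)
  have hfn' := fejer_nonneg (Real.log n - (w + -1))
  by_cases hclose : |Real.log n - w| < δ
  · have hnp : ¬ n.Prime := fun hp => (hno n hp).not_gt hclose
    rw [if_pos (by linarith [(abs_lt.mp hclose).1])]
    simp only [hb, if_neg hnp]
    have h1 := mul_le_of_le_one_right han (fejer_le_one (R * (Real.log n - w)))
    have h2 : 0 ≤ C / R ^ 2 * (a n / n * fejer (Real.log n - w) +
      a n / n * fejer (Real.log n - (w + -1))) := by positivity
    linarith
  · rw [not_lt] at hclose
    have h0 : 0 ≤ if w - δ < Real.log n then b n else 0 := by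
      split_ifs
      exacts [hbnn n, le_rfl]
    set u := Real.log n - w with hu
    have hu0 : 0 < u ^ 2 := by
      have : 0 < |u| := hδ.trans_le hclose
      exact sq_pos_of_ne_zero (abs_pos.mp this)
    have h1 : fejer (R * u) ≤ C / R ^ 2 * (fejer u + fejer (u + 1)) := by
      have h2 : fejer (R * u) ≤ 4 / (R * u) ^ 2 := by
        rw [le_div_iff₀ (by rw [mul_pow]; positivity)]
        exact fejer_mul_sq_le _
      calc fejer (R * u) ≤ 4 / (R * u) ^ 2 := h2
        _ = 1 / R ^ 2 * (4 / u ^ 2) := by field_simp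
        _ ≤ 1 / R ^ 2 * (C * (fejer u + fejer (u + 1))) := by gcongr; exact hC u hclose
        _ = _ := by ring
    rw [show Real.log n - (w + -1) = u + 1 by rw [hu]; ring]
    have := mul_le_mul_of_nonneg_left h1 han
    linarith

theorem eventually_primeCeil_le {ρ : ℝ} (hρ : 1 < ρ) :
    ∀ᶠ x : ℝ in atTop, (primeCeil x : ℝ) ≤ ρ * x := by
  have hδ : 0 < Real.log ρ / 2 := half_pos (Real.log_pos hρ)
  -- Centring at `w = log x + (log ρ)/2` with radius `(log ρ)/2` places `log p` between `log x` and
  -- `log (ρx)`.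
  have h := (Real.tendsto_log_atTop.comp (tendsto_id.const_mul_atTop
    (Real.exp_pos (Real.log ρ / 2)))).eventually (eventually_exists_prime_log hδ)
  filter_upwards [h, eventually_gt_atTop 0] with x ⟨p, hp, hpx⟩ hx
  simp only [Function.comp, id] at hpx
  rw [Real.log_mul (Real.exp_ne_zero _) hx.ne', Real.log_exp, abs_lt] at hpx
  have hp0 : (0 : ℝ) < p := Nat.cast_pos.mpr hp.pos
  have h1 : x ≤ p := (Real.log_le_log_iff hx hp0).mp (by linarith)
  have h2 : (p : ℝ) ≤ ρ * x := by
    rw [← Real.log_le_log_iff hp0 (by positivity), Real.log_mul (by positivity) hx.ne']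
    linarith
  refine le_trans ?_ h2
  exact_mod_cast Nat.sInf_le (s := {p : ℕ | p.Prime ∧ x ≤ (p : ℝ)}) ⟨hp, h1⟩

theorem tendsto_primeCeil_div {y : ℝ} (hy : 0 < y) :
    Tendsto (fun X : ℝ => (primeCeil (y * X) : ℝ) / X) atTop (𝓝 y) := by
  rw [Metric.tendsto_atTop']
  intro ε hε
  have h := (tendsto_id.const_mul_atTop hy).eventually
    (eventually_primeCeil_le (ρ := 1 + ε / (2 * y)) (by
      have : 0 < ε / (2 * y) := by positivity
      linarith))
  obtain ⟨N, hN⟩ := (h.and (eventually_gt_atTop 0)).exists_forall_of_atTop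
  refine ⟨N, fun X hX => ?_⟩
  obtain ⟨h1, hX0⟩ := hN X hX.le
  have h2 := (primeCeil_spec (y * X)).2
  simp only [id] at h1
  rw [Real.dist_eq, abs_of_nonneg (by rw [sub_nonneg, le_div_iff₀ hX0]; exact h2), sub_lt_iff_lt_add,
    div_lt_iff₀ hX0]
  have : (1 + ε / (2 * y)) * (y * X) = y * X + ε / 2 * X := by field_simp
  nlinarith

end Murmuration

/-! ### The mean value of `φ(n)/n` off the class `2 mod 4`. -/

namespace Murmuration
open MeasureTheory Filter Topology
open ArithmeticFunction (moebius)

theorem totient_div_eq_sum_moebius {n : ℕ} (hn : 0 < n) :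
    (n.totient : ℝ) / n = ∑ d ∈ n.divisors, (moebius d : ℝ) / d := by
  have h := (ArithmeticFunction.sum_eq_iff_sum_mul_moebius_eq (R := ℝ)
    (f := fun n => (n.totient : ℝ)) (g := fun n => (n : ℝ))).mp
    (fun n _ => by exact_mod_cast Nat.sum_totient n) n hn
  rw [← h, Finset.sum_div, Nat.sum_divisorsAntidiagonal
    (fun d e => (moebius d : ℝ) * (e : ℝ) / n)]
  refine Finset.sum_congr rfl fun d hd => ?_
  obtain ⟨e, rfl⟩ := Nat.dvd_of_mem_divisors hd
  have hd0 : 0 < d := Nat.pos_of_mul_pos_right hn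
  have he0 : 0 < e := Nat.pos_of_mul_pos_left hn
  rw [Nat.mul_div_cancel_left _ hd0]
  push_cast
  field_simp

/-- `φ(n) / n` off the residue class `2 mod 4`. -/
noncomputable def totientWeight (n : ℕ) : ℝ := if n ≡ 2 [MOD 4] then 0 else (n.totient : ℝ) / n

theorem totientWeight_nonneg (n : ℕ) : 0 ≤ totientWeight n := by
  unfold totientWeight
  split_ifs <;> positivity

theorem totientWeight_le_one (n : ℕ) : totientWeight n ≤ 1 := by
  unfold totientWeight
  split_ifs
  · exact zero_le_one
  · exact div_le_one_of_le₀ (by exact_mod_cast Nat.totient_le n) n.cast_nonneg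

/-- The number of `m ∈ [1, n]` divisible by `d` and not congruent to `2` modulo `4`. -/
def sievedCount (n d : ℕ) : ℝ := (n / d : ℕ) - (n / Nat.lcm 2 d : ℕ) + (n / Nat.lcm 4 d : ℕ)

theorem sum_ite_dvd (n d : ℕ) :
    ∑ m ∈ Finset.Ioc 0 n, (if d ∣ m then (1 : ℝ) else 0) = (n / d : ℕ) := by
  rw [Finset.sum_ite, Finset.sum_const_zero, add_zero, Finset.sum_const, nsmul_eq_mul, mul_one,
    Nat.Ioc_filter_dvd_card_eq_div]

theorem sievedCount_eq (n d : ℕ) : sievedCount n d =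
    ∑ m ∈ Finset.Ioc 0 n, if m ≡ 2 [MOD 4] then (0 : ℝ) else if d ∣ m then 1 else 0 := by
  unfold sievedCount
  rw [← sum_ite_dvd, ← sum_ite_dvd, ← sum_ite_dvd, ← Finset.sum_sub_distrib,
    ← Finset.sum_add_distrib]
  refine Finset.sum_congr rfl fun m _ => ?_
  have h4 : m ≡ 2 [MOD 4] ↔ 2 ∣ m ∧ ¬ 4 ∣ m := by
    unfold Nat.ModEq
    omega
  have h24 : 4 ∣ m → 2 ∣ m := fun h => (by norm_num : 2 ∣ 4).trans h
  simp only [Nat.lcm_dvd_iff, h4]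
  by_cases hd : d ∣ m <;> by_cases h2 : 2 ∣ m <;> by_cases h4' : 4 ∣ m <;>
    first
    | exact absurd (h24 h4') h2
    | simp only [hd, h2, h4', and_true, and_false, not_true, not_false_eq_true, if_true, if_false]
      norm_num

theorem sievedCount_nonneg (n d : ℕ) : 0 ≤ sievedCount n d := by
  rw [sievedCount_eq]
  exact Finset.sum_nonneg fun m _ => by split_ifs <;> norm_num

theorem sievedCount_le (n d : ℕ) : sievedCount n d ≤ (n : ℝ) / d := by
  refine le_trans ?_ (Nat.cast_div_le (α := ℝ))
  rw [sievedCount_eq, ← sum_ite_dvd]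
  exact Finset.sum_le_sum fun m _ => by split_ifs <;> norm_num

/-- Expand `φ(m)/m = ∑_{d ∣ m} μ(d)/d` and exchange sums. Writing the result over all `d` prepares a
termwise limit. -/
theorem sum_totientWeight (n : ℕ) :
    ∑ m ∈ Finset.Icc 0 n, totientWeight m = ∑' d : ℕ, (moebius d : ℝ) / d * sievedCount n d := by
  rw [tsum_eq_sum (s := Finset.Ioc 0 n)]
  · have h0 : ∑ m ∈ Finset.Icc 0 n, totientWeight m = ∑ m ∈ Finset.Ioc 0 n, totientWeight m := by
      rw [← Finset.add_sum_Ioc_eq_sum_Icc (Nat.zero_le n)]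
      simp [totientWeight]
    rw [h0]
    simp_rw [sievedCount_eq, Finset.mul_sum]
    rw [Finset.sum_comm]
    refine Finset.sum_congr rfl fun m hm => ?_
    rw [Finset.mem_Ioc] at hm
    unfold totientWeight
    split_ifs with h
    · simp
    · rw [totient_div_eq_sum_moebius hm.1]
      simp only [mul_ite, mul_one, mul_zero]
      rw [← Finset.sum_filter]
      refine Finset.sum_congr ?_ fun _ _ => rfl
      ext d
      simp only [Nat.mem_divisors, Finset.mem_filter, Finset.mem_Ioc]
      constructor
      · rintro ⟨hd, _⟩
        exact ⟨⟨Nat.pos_of_dvd_of_pos hd hm.1, (Nat.le_of_dvd hm.1 hd).trans hm.2⟩, hd⟩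
      · rintro ⟨_, hd⟩
        exact ⟨hd, by omega⟩
  · intro d hd
    rw [Finset.mem_Ioc, not_and_or, not_lt, not_le] at hd
    rcases hd with hd | hd
    · simp [Nat.le_zero.mp hd]
    · have h1 : sievedCount n d = 0 := by
        have h2 (k : ℕ) (hk : 0 < k) : n / Nat.lcm k d = 0 :=
          Nat.div_eq_of_lt (hd.trans_le (Nat.le_of_dvd (Nat.lcm_pos hk (by omega))
            (Nat.dvd_lcm_right k d)))
        simp [sievedCount, h2, Nat.div_eq_of_lt hd]
      rw [h1, mul_zero]

theorem tendsto_floor_div (m : ℕ) :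
    Tendsto (fun x : ℝ => ((⌊x⌋₊ / m : ℕ) : ℝ) / x) atTop (𝓝 (1 / m)) := by
  refine (tendsto_nat_floor_mul_div_atTop (R := ℝ) (a := 1 / m) (by positivity)).congr fun x => ?_
  rw [one_div_mul_eq_div, Nat.floor_div_natCast]

/-- The density of the integers divisible by `d` and not congruent to `2` modulo `4`. -/
noncomputable def sievedDensity (d : ℕ) : ℝ := 1 / d - 1 / Nat.lcm 2 d + 1 / Nat.lcm 4 d

/-- Dominated convergence for series: since `sievedCount ⌊x⌋₊ d / x ≤ 1/d`, the terms are bounded by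
`1/d²` uniformly in `x`. -/
theorem tendsto_sum_totientWeight_tsum :
    Tendsto (fun x : ℝ => (∑ m ∈ Finset.Icc 0 ⌊x⌋₊, totientWeight m) / x) atTop
      (𝓝 (∑' d : ℕ, (moebius d : ℝ) / d * sievedDensity d)) := by
  simp_rw [sum_totientWeight, ← tsum_div_const]
  refine tendsto_tsum_of_dominated_convergence (bound := fun d : ℕ => 1 / (d : ℝ) ^ 2)
    (Real.summable_one_div_nat_pow.mpr (by norm_num)) (fun d => ?_) ?_
  · simp_rw [mul_div_assoc]
    refine Tendsto.const_mul _ ?_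
    refine (((tendsto_floor_div d).sub (tendsto_floor_div (Nat.lcm 2 d))).add
      (tendsto_floor_div (Nat.lcm 4 d))).congr fun x => ?_
    rw [sievedCount]
    ring
  · filter_upwards [eventually_gt_atTop 0] with x hx d
    have hμ : |(moebius d : ℝ)| ≤ 1 := by exact_mod_cast ArithmeticFunction.abs_moebius_le_one
    have h1 : sievedCount ⌊x⌋₊ d / x ≤ 1 / d := by
      rw [div_le_iff₀ hx, one_div_mul_eq_div]
      exact (sievedCount_le _ _).trans (by gcongr; exact Nat.floor_le hx.le)
    rw [mul_div_assoc, norm_mul, norm_div, Real.norm_eq_abs,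
      Real.norm_of_nonneg (div_nonneg (sievedCount_nonneg _ _) hx.le), Real.norm_natCast]
    calc |(moebius d : ℝ)| / d * (sievedCount ⌊x⌋₊ d / x) ≤ 1 / d * (1 / d) := by
          gcongr
          exact div_nonneg (sievedCount_nonneg _ _) hx.le
      _ = _ := by ring

theorem summable_moebius_div_sq : Summable fun d : ℕ => (moebius d : ℝ) / (d : ℝ) ^ 2 := by
  refine Summable.of_norm_bounded (g := fun d : ℕ => 1 / (d : ℝ) ^ 2)
    (Real.summable_one_div_nat_pow.mpr (by norm_num)) fun d => ?_
  have hμ : |(moebius d : ℝ)| ≤ 1 := by exact_mod_cast ArithmeticFunction.abs_moebius_le_one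
  rw [norm_div, Real.norm_eq_abs, norm_pow, Real.norm_natCast]
  gcongr

theorem tsum_moebius_div_sq : ∑' d : ℕ, (moebius d : ℝ) / (d : ℝ) ^ 2 = 6 / Real.pi ^ 2 := by
  have h := ArithmeticFunction.LSeries_zeta_mul_Lseries_moebius (s := 2) (by norm_num)
  rw [ArithmeticFunction.LSeries_zeta_eq_riemannZeta (by norm_num), riemannZeta_two] at h
  have h2 : LSeries (fun n => ((moebius n : ℤ) : ℂ)) 2 =
      ((∑' d : ℕ, (moebius d : ℝ) / (d : ℝ) ^ 2 : ℝ) : ℂ) := by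
    rw [Complex.ofReal_tsum, LSeries]
    refine tsum_congr fun n => ?_
    rcases eq_or_ne n 0 with rfl | hn
    · simp
    · rw [LSeries.term_of_ne_zero hn]
      norm_cast
  rw [h2] at h
  have hpi := Real.pi_ne_zero
  have h3 : Real.pi ^ 2 / 6 * ∑' d : ℕ, (moebius d : ℝ) / (d : ℝ) ^ 2 = 1 := by
    exact_mod_cast h
  rw [eq_div_iff (by positivity)]
  linarith

theorem moebius_two_mul_of_even {m : ℕ} (hm : 2 ∣ m) : moebius (2 * m) = 0 := by
  refine ArithmeticFunction.moebius_eq_zero_of_not_squarefree fun h => ?_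
  have := h 2 (Nat.mul_dvd_mul_left 2 hm)
  rw [Nat.isUnit_iff] at this
  omega

theorem moebius_two_mul_of_odd {m : ℕ} (hm : ¬ 2 ∣ m) : moebius (2 * m) = -moebius m := by
  rw [ArithmeticFunction.isMultiplicative_moebius.map_mul_of_coprime
    ((Nat.Prime.coprime_iff_not_dvd Nat.prime_two).mpr hm),
    ArithmeticFunction.moebius_apply_prime Nat.prime_two]
  ring

/-- The density is `3/(4d)` for odd `d` and `1/(2d)` for `d ≡ 2 mod 4`, while `μ(d) = 0` if `4 ∣ d`.
Hence the weight `1/2`, plus `1/4` for odd `d`. -/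
theorem moebius_div_mul_sievedDensity (d : ℕ) : (moebius d : ℝ) / d * sievedDensity d =
    1 / 2 * ((moebius d : ℝ) / (d : ℝ) ^ 2) +
      1 / 4 * (if 2 ∣ d then 0 else (moebius d : ℝ) / (d : ℝ) ^ 2) := by
  unfold sievedDensity
  split_ifs with h
  · obtain ⟨m, rfl⟩ := h
    by_cases hm : 2 ∣ m
    · simp [moebius_two_mul_of_even hm]
    · have h2 : Nat.lcm 2 (2 * m) = 2 * m := Nat.lcm_eq_right (Dvd.intro m rfl)
      have h4 : Nat.lcm 4 (2 * m) = 4 * m := by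
        rw [show 4 = 2 * 2 by rfl, Nat.lcm_mul_left, Nat.Coprime.lcm_eq_mul
          ((Nat.Prime.coprime_iff_not_dvd Nat.prime_two).mpr hm)]
        ring
      have hm0 : (m : ℝ) ≠ 0 := by
        rintro h
        rw [Nat.cast_eq_zero] at h
        exact hm (h ▸ dvd_zero 2)
      rw [h2, h4]
      push_cast
      field_simp
      ring
  · have hc : Nat.Coprime 2 d := (Nat.Prime.coprime_iff_not_dvd Nat.prime_two).mpr h
    have hc4 : Nat.Coprime 4 d := Nat.Coprime.pow_left 2 hc
    have hm0 : (d : ℝ) ≠ 0 := by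
      rintro h'
      rw [Nat.cast_eq_zero] at h'
      exact h (h' ▸ dvd_zero 2)
    rw [hc.lcm_eq_mul, hc4.lcm_eq_mul]
    push_cast
    field_simp
    ring

/-- Even terms satisfy `t(2k) = -t(k)/4` for odd `k` and vanish for even `k`, so the full sum `6/π²`
is `3/4` of the odd one. -/
theorem tsum_odd_moebius_div_sq :
    ∑' d : ℕ, (if 2 ∣ d then 0 else (moebius d : ℝ) / (d : ℝ) ^ 2) = 8 / Real.pi ^ 2 := by
  set t : ℕ → ℝ := fun d => (moebius d : ℝ) / (d : ℝ) ^ 2 with ht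
  have hts : Summable t := summable_moebius_div_sq
  have hinj2 : Function.Injective fun k : ℕ => 2 * k := fun a b h => by simpa using h
  have hinj1 : Function.Injective fun k : ℕ => 2 * k + 1 := fun a b h => by simpa using h
  have hos : Summable fun d => if 2 ∣ d then 0 else t d :=
    Summable.of_norm_bounded hts.norm fun d => by split_ifs <;> simp
  have h1 := tsum_even_add_odd (f := t) (hts.comp_injective hinj2) (hts.comp_injective hinj1)
  have h2 := tsum_even_add_odd (f := fun d => if 2 ∣ d then 0 else t d)
    (hos.comp_injective hinj2) (hos.comp_injective hinj1)
  have h3 (k : ℕ) : t (2 * k) = -(1 / 4) * if 2 ∣ k then 0 else t k := by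
    split_ifs with h
    · simp [ht, moebius_two_mul_of_even h]
    · simp only [ht, moebius_two_mul_of_odd h]
      push_cast
      ring
  have h4 (k : ℕ) : ¬ 2 ∣ 2 * k + 1 := by omega
  simp only [dvd_mul_right, if_true, tsum_zero, h4, if_false, zero_add] at h2
  simp_rw [h3, tsum_mul_left] at h1
  rw [h2, ht, tsum_moebius_div_sq] at h1
  have : (8 : ℝ) / Real.pi ^ 2 = 4 / 3 * (6 / Real.pi ^ 2) := by ring
  linarith

theorem tendsto_sum_totientWeight :
    Tendsto (fun x : ℝ => (∑ m ∈ Finset.Icc 0 ⌊x⌋₊, totientWeight m) / x) atTop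
      (𝓝 (5 / Real.pi ^ 2)) := by
  convert! tendsto_sum_totientWeight_tsum using 2
  simp_rw [moebius_div_mul_sievedDensity]
  have hos : Summable fun d : ℕ => if 2 ∣ d then 0 else (moebius d : ℝ) / (d : ℝ) ^ 2 :=
    Summable.of_norm_bounded summable_moebius_div_sq.norm fun d => by
      split_ifs
      · rw [norm_zero]; exact norm_nonneg _
      · exact le_rfl
  rw [(summable_moebius_div_sq.mul_left _).tsum_add (hos.mul_left _), tsum_mul_left, tsum_mul_left,
    tsum_moebius_div_sq, tsum_odd_moebius_div_sq]
  ring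

end Murmuration

/-! ### Abel summation against smooth weights. -/

namespace Murmuration
open MeasureTheory Filter Topology

/-- A bounded nonnegative sequence with a mean value is equidistributed against `C¹` weights. -/
theorem tendsto_weighted_mean {h : ℕ → ℝ} (h0 : ∀ n, 0 ≤ h n) (h1 : ∀ n, h n ≤ 1) {κ : ℝ}
    (hκ : Tendsto (fun x : ℝ => (∑ k ∈ Finset.Icc 0 ⌊x⌋₊, h k) / x) atTop (𝓝 κ))
    {c : ℝ} (hc : 1 < c) {f f' : ℝ → ℝ} (hf : ∀ x ∈ Set.Icc 1 c, HasDerivAt f (f' x) x)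
    (hf' : ContinuousOn f' (Set.Icc 1 c)) :
    Tendsto (fun X : ℝ => (∑ k ∈ Finset.Ioc ⌊X⌋₊ ⌊c * X⌋₊, f (k / X) * h k) / X) atTop
      (𝓝 (κ * ∫ x in (1 : ℝ)..c, f x)) := by
  set H : ℝ → ℝ := fun x => ∑ k ∈ Finset.Icc 0 ⌊x⌋₊, h k with hH
  have hscale {u : ℝ} (hu : 0 < u) : Tendsto (fun X : ℝ => H (X * u) / X) atTop (𝓝 (κ * u)) := by
    have := (hκ.comp (tendsto_id.atTop_mul_const hu)).mul_const u
    refine this.congr' ?_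
    filter_upwards [eventually_gt_atTop 0] with X hX
    simp only [Function.comp, id, hH]
    field_simp
  have hH0 (x : ℝ) : 0 ≤ H x := Finset.sum_nonneg fun k _ => h0 k
  have hHle {x : ℝ} (hx : 0 ≤ x) : H x ≤ x + 1 := by
    calc H x ≤ ∑ k ∈ Finset.Icc 0 ⌊x⌋₊, (1 : ℝ) := Finset.sum_le_sum fun k _ => h1 k
      _ = ⌊x⌋₊ + 1 := by simp
      _ ≤ x + 1 := by gcongr; exact Nat.floor_le hx
  have hHm : Measurable H :=
    (measurable_from_nat (f := fun n => ∑ k ∈ Finset.Icc 0 n, h k)).comp Nat.measurable_floor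
  have habel : ∀ᶠ X : ℝ in atTop,
      (∑ k ∈ Finset.Ioc ⌊X⌋₊ ⌊c * X⌋₊, f (k / X) * h k) / X =
        f c * (H (X * c) / X) - f 1 * (H (X * 1) / X) -
          ∫ u in (1 : ℝ)..c, f' u * (H (X * u) / X) := by
    filter_upwards [eventually_gt_atTop 0] with X hX
    have hXc : X ≤ c * X := by nlinarith
    have hd : ∀ t ∈ Set.Icc X (c * X), HasDerivAt (fun t => f (t / X)) (f' (t / X) / X) t := by
      intro t ht
      have hm : t / X ∈ Set.Icc 1 c := ⟨(one_le_div hX).mpr ht.1, (div_le_iff₀ hX).mpr ht.2⟩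
      have := (hf _ hm).comp t ((hasDerivAt_id t).div_const X)
      exact this.congr_deriv (mul_one_div _ _)
    have hcont : ContinuousOn (fun t => f' (t / X) / X) (Set.Icc X (c * X)) := by
      refine ContinuousOn.div_const (hf'.comp (by fun_prop) fun t ht => ?_) X
      exact ⟨(one_le_div hX).mpr ht.1, (div_le_iff₀ hX).mpr ht.2⟩
    have hint : IntegrableOn (deriv fun t => f (t / X)) (Set.Icc X (c * X)) :=
      (hcont.integrableOn_Icc).congr_fun (fun t ht => (hd t ht).deriv.symm) measurableSet_Icc
    have hab := sum_mul_eq_sub_sub_integral_mul h (f := fun t => f (t / X)) hX.le hXc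
      (fun t ht => (hd t ht).differentiableAt) hint
    rw [hab]
    have e1 : ∫ t in Set.Ioc X (c * X), deriv (fun t => f (t / X)) t *
        ∑ k ∈ Finset.Icc 0 ⌊t⌋₊, h k = X * ∫ u in (1 : ℝ)..c, f' u * (H (X * u) / X) := by
      have e2 := intervalIntegral.integral_comp_div (a := X) (b := c * X)
        (fun u => f' u * (H (X * u) / X)) hX.ne'
      rw [div_self hX.ne', mul_div_cancel_right₀ _ hX.ne', smul_eq_mul] at e2
      rw [← e2, intervalIntegral.integral_of_le hXc]
      refine setIntegral_congr_fun measurableSet_Ioc fun t ht => ?_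
      simp only [(hd t ⟨ht.1.le, ht.2⟩).deriv, mul_div_cancel₀ t hX.ne', hH]
      ring
    rw [e1, mul_div_cancel_right₀ _ hX.ne', div_self hX.ne', mul_comm X c, mul_one]
    simp only [hH]
    field_simp
  have hI : Tendsto (fun X : ℝ => ∫ u in (1 : ℝ)..c, f' u * (H (X * u) / X)) atTop
      (𝓝 (∫ u in (1 : ℝ)..c, f' u * (κ * u))) := by
    -- For `X ≥ 1` and `u ≤ c`, `H (X * u) ≤ X * u + 1 ≤ (c + 1) * X`.
    refine intervalIntegral.tendsto_integral_filter_of_dominated_convergence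
      (fun u => |f' u| * (c + 1)) ?_ ?_ ?_ ?_
    · refine Eventually.of_forall fun X => ?_
      rw [Set.uIoc_of_le hc.le]
      refine AEStronglyMeasurable.mul ?_ ?_
      · exact ((hf'.mono Set.Ioc_subset_Icc_self).aestronglyMeasurable measurableSet_Ioc)
      · exact ((hHm.comp (measurable_const_mul X)).div_const X).aestronglyMeasurable
    · filter_upwards [eventually_ge_atTop 1] with X hX
      refine Eventually.of_forall fun u hu => ?_
      rw [Set.uIoc_of_le hc.le] at hu
      have hX0 : 0 < X := by linarith
      have hu0 : 0 ≤ X * u := mul_nonneg hX0.le (by linarith [hu.1])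
      rw [norm_mul, Real.norm_eq_abs, Real.norm_of_nonneg (div_nonneg (hH0 _) hX0.le)]
      refine mul_le_mul_of_nonneg_left ?_ (abs_nonneg _)
      rw [div_le_iff₀ hX0]
      have := hHle hu0
      nlinarith [hu.2]
    · refine ContinuousOn.intervalIntegrable ?_
      rw [Set.uIcc_of_le hc.le]
      exact hf'.abs.mul continuousOn_const
    · refine Eventually.of_forall fun u hu => ?_
      rw [Set.uIoc_of_le hc.le] at hu
      exact (hscale (by linarith [hu.1])).const_mul _
  -- Integration by parts undoes the Abel summation in the limit, where `H (X * u) / X` has become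
  -- `κ * u`.
  have hparts : κ * ∫ x in (1 : ℝ)..c, f x =
      f c * (κ * c) - f 1 * (κ * 1) - ∫ u in (1 : ℝ)..c, f' u * (κ * u) := by
    have := intervalIntegral.integral_mul_deriv_eq_deriv_mul (a := 1) (b := c) (u := fun x => κ * x)
      (u' := fun _ => κ) (v := f) (v' := f')
      (fun x _ => by simpa using (hasDerivAt_id x).const_mul κ)
      (fun x hx => hf x (by rwa [Set.uIcc_of_le hc.le] at hx)) (by simp)
      (ContinuousOn.intervalIntegrable (by rwa [Set.uIcc_of_le hc.le]))
    rw [intervalIntegral.integral_const_mul] at this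
    simp_rw [mul_comm (f' _)]
    rw [this]
    ring
  rw [hparts]
  refine Tendsto.congr' (habel.mono fun X hX => hX.symm) ?_
  exact (((hscale (by linarith)).const_mul _).sub ((hscale one_pos).const_mul _)).sub hI

end Murmuration

/-! ### Gauss sums and the evaluation of one modulus. -/

namespace Murmuration
open Finset
open ZMod (stdAddChar)

/-- Primitivity gives `χ⁻¹(a) τ(χ) = ∑_b χ(b) e(ab/N)` even for non-units `a`. Multiplying by
`e(a/N)` and summing over all `a` leaves only `b = -1`. -/
theorem gaussSum_mul_gaussSum_inv {N : ℕ} [NeZero N] {χ : DirichletCharacter ℂ N}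
    (hχ : χ.IsPrimitive) :
    gaussSum χ stdAddChar * gaussSum χ⁻¹ stdAddChar = χ (-1) * N := by
  have h1 (a : ZMod N) : gaussSum χ stdAddChar * (χ⁻¹ a * stdAddChar a) =
      ∑ b, χ b * stdAddChar (a * (b + 1)) := by
    calc _ = stdAddChar a * (χ⁻¹ a * gaussSum χ stdAddChar) := by ring
      _ = stdAddChar a * gaussSum χ (stdAddChar.mulShift a) := by
        rw [gaussSum_mulShift_of_isPrimitive _ hχ]
      _ = _ := by
        rw [gaussSum, mul_sum]
        refine sum_congr rfl fun b _ => ?_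
        rw [AddChar.mulShift_apply, mul_add, mul_one, AddChar.map_add_eq_mul]
        ring
  rw [gaussSum.eq_1 χ⁻¹, mul_sum, sum_congr rfl fun a _ => h1 a, sum_comm]
  simp_rw [← mul_sum, AddChar.sum_mulShift _ (ZMod.isPrimitive_stdAddChar N)]
  rw [sum_eq_single (-1)]
  · simp
  · intro b _ hb
    rw [if_neg (fun h => hb (eq_neg_of_add_eq_zero_left h))]
    simp
  · simp

theorem sum_norm_sq_gaussSum_one (N : ℕ) [NeZero N] :
    ∑ a : ZMod N, ‖gaussSum (1 : DirichletCharacter ℂ N) (stdAddChar.mulShift a)‖ ^ 2 =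
      N * N.totient := by
  have h1 (a : ZMod N) : ((‖gaussSum (1 : DirichletCharacter ℂ N) (stdAddChar.mulShift a)‖ ^ 2 : ℝ)
      : ℂ) = ∑ b, ∑ b', (1 : DirichletCharacter ℂ N) b * (1 : DirichletCharacter ℂ N) b' *
        stdAddChar (a * (b - b')) := by
    have hstar : (starRingEnd ℂ) (gaussSum (1 : DirichletCharacter ℂ N) (stdAddChar.mulShift a)) =
        ∑ b', (1 : DirichletCharacter ℂ N) b' * stdAddChar (-(a * b')) := by
      rw [gaussSum, map_sum]
      refine sum_congr rfl fun b _ => ?_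
      rw [map_mul, AddChar.mulShift_apply, AddChar.map_neg_eq_conj]
      congr 1
      by_cases hb : IsUnit b
      · simp [MulChar.one_apply hb]
      · simp [MulChar.map_nonunit _ hb]
    rw [Complex.ofReal_pow, ← Complex.mul_conj', hstar, gaussSum, sum_mul_sum]
    refine sum_congr rfl fun b _ => sum_congr rfl fun b' _ => ?_
    rw [AddChar.mulShift_apply, mul_sub, sub_eq_add_neg, AddChar.map_add_eq_mul]
    ring
  have h2 : ((∑ a : ZMod N, ‖gaussSum (1 : DirichletCharacter ℂ N) (stdAddChar.mulShift a)‖ ^ 2 : ℝ)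
      : ℂ) = ((N * N.totient : ℝ) : ℂ) := by
    rw [Complex.ofReal_sum, sum_congr rfl fun a _ => h1 a, sum_comm]
    have h3 (b : ZMod N) : ∑ a : ZMod N, ∑ b', (1 : DirichletCharacter ℂ N) b *
        (1 : DirichletCharacter ℂ N) b' * stdAddChar (a * (b - b')) =
          N * (1 : DirichletCharacter ℂ N) b := by
      rw [sum_comm]
      simp_rw [← mul_sum, AddChar.sum_mulShift _ (ZMod.isPrimitive_stdAddChar N)]
      rw [sum_eq_single b]
      · by_cases hb : IsUnit b
        · simp [MulChar.one_apply hb]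
        · simp [MulChar.map_nonunit _ hb]
      · intro b' _ hb
        rw [if_neg (fun h => hb (sub_eq_zero.mp h).symm)]
        simp
      · simp
    rw [sum_congr rfl fun b _ => h3 b, ← mul_sum, MulChar.sum_one_eq_card_units,
      ZMod.card_units_eq_totient]
    push_cast
    rfl
  exact_mod_cast h2

/-- The shifted sums at the `φ(N)` units all equal the unshifted one, so Parseval gives `φ(N)‖τ‖² ≤
Nφ(N)`. This crude bound is enough, since it is later divided by `N`. -/
theorem norm_gaussSum_one_le (N : ℕ) [NeZero N] :
    ‖gaussSum (1 : DirichletCharacter ℂ N) stdAddChar‖ ≤ Real.sqrt N := by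
  apply Real.le_sqrt_of_sq_le
  have hφ : (0 : ℝ) < N.totient := Nat.cast_pos.mpr (Nat.totient_pos.mpr (NeZero.pos N))
  have h1 : ∑ u : (ZMod N)ˣ, ‖gaussSum (1 : DirichletCharacter ℂ N) stdAddChar‖ ^ 2 ≤
      ∑ a : ZMod N, ‖gaussSum (1 : DirichletCharacter ℂ N) (stdAddChar.mulShift a)‖ ^ 2 := by
    calc _ = ∑ u : (ZMod N)ˣ, ‖gaussSum (1 : DirichletCharacter ℂ N)
          (stdAddChar.mulShift (u : ZMod N))‖ ^ 2 := by
          refine sum_congr rfl fun u _ => ?_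
          rw [← gaussSum_mulShift (1 : DirichletCharacter ℂ N) stdAddChar u,
            MulChar.one_apply u.isUnit, one_mul]
      _ = ∑ a ∈ univ.map ⟨((↑) : (ZMod N)ˣ → ZMod N), Units.val_injective⟩,
          ‖gaussSum (1 : DirichletCharacter ℂ N) (stdAddChar.mulShift a)‖ ^ 2 := by
          rw [sum_map]
          rfl
      _ ≤ _ := sum_le_sum_of_subset_of_nonneg (subset_univ _) fun _ _ _ => by positivity
  rw [sum_norm_sq_gaussSum_one, sum_const, card_univ, ZMod.card_units_eq_totient, nsmul_eq_mul]
    at h1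
  nlinarith

/-- Expanding the Gauss sum, orthogonality of characters selects the residue `b = p`. -/
theorem sum_gaussSum_inv_mul {N : ℕ} [NeZero N] {p : ZMod N} (hp : IsUnit p) :
    ∑ χ : DirichletCharacter ℂ N, gaussSum χ⁻¹ stdAddChar * χ p = N.totient * stdAddChar p := by
  rw [← Equiv.sum_comp (Equiv.inv (DirichletCharacter ℂ N))]
  have h (χ : DirichletCharacter ℂ N) : χ⁻¹ p = χ p⁻¹ := by
    obtain ⟨u, rfl⟩ := hp
    rw [MulChar.inv_apply, Ring.inverse_unit, ZMod.inv_coe_unit]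
  simp only [Equiv.inv_apply, inv_inv, h, gaussSum, sum_mul]
  rw [sum_comm]
  have h2 (b : ZMod N) : ∑ χ : DirichletCharacter ℂ N, χ b * stdAddChar b * χ p⁻¹ =
      (if p = b then (N.totient : ℂ) else 0) * stdAddChar b := by
    rw [← DirichletCharacter.sum_char_inv_mul_char_eq ℂ hp b, sum_mul]
    exact sum_congr rfl fun χ _ => by ring
  rw [sum_congr rfl fun b _ => h2 b]
  simp

-- The parity condition is detected by `(1 + ε χ(-1))/2`, and the factor `χ(-1)` replaces `p` by
-- `-p`.
open Classical in
theorem sum_parity_gaussSum_inv_mul {N : ℕ} [NeZero N] (ε : ℤˣ) {p : ZMod N} (hp : IsUnit p) :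
    ∑ χ : DirichletCharacter ℂ N with χ (-1) = ((ε : ℤ) : ℂ), gaussSum χ⁻¹ stdAddChar * χ p =
      N.totient / 2 * (stdAddChar p + ((ε : ℤ) : ℂ) * stdAddChar (-p)) := by
  have h (χ : DirichletCharacter ℂ N) :
      (if χ (-1) = ((ε : ℤ) : ℂ) then gaussSum χ⁻¹ stdAddChar * χ p else 0) =
        1 / 2 * (gaussSum χ⁻¹ stdAddChar * χ p) +
          ((ε : ℤ) : ℂ) / 2 * (gaussSum χ⁻¹ stdAddChar * χ (-p)) := by
    rw [← neg_one_mul p, map_mul]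
    rcases χ.even_or_odd with h | h <;> rcases Int.units_eq_one_or ε with rfl | rfl
    · rw [h]; simp; ring
    · rw [h]; norm_num
    · rw [h]; norm_num
    · rw [h]; simp; ring
  rw [sum_filter, sum_congr rfl fun χ _ => h χ, sum_add_distrib, ← mul_sum, ← mul_sum,
    sum_gaussSum_inv_mul hp, sum_gaussSum_inv_mul hp.neg]
  ring

/-- The contribution of the modulus `N` to `X * T ε y X c`. -/
noncomputable def modulusTerm (ε : ℤˣ) (p N : ℕ) : ℂ :=
  ∑ χ ∈ primitiveChars ε N, χ (p : ZMod N) / tau χ +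
    ((ε : ℤ) : ℂ) * (1 / (N : ℂ) * ∑ χ ∈ imprimitiveChars ε N, tau (star χ) * χ (p : ZMod N))

/-- The main term of `modulusTerm`. -/
noncomputable def mainTerm (ε : ℤˣ) (p N : ℕ) : ℂ :=
  ((ε : ℤ) : ℂ) / N * (N.totient / 2 *
    (Complex.exp (2 * Real.pi * Complex.I * p / N) +
      ((ε : ℤ) : ℂ) * Complex.exp (-(2 * Real.pi * Complex.I * p / N))))

theorem primitive_term_eq {N : ℕ} [NeZero N] (ε : ℤˣ) {χ : DirichletCharacter ℂ N}
    (hχ : χ ∈ primitiveChars ε N) (a : ZMod N) :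
    χ a / tau χ = ((ε : ℤ) : ℂ) / N * (gaussSum χ⁻¹ stdAddChar * χ a) := by
  simp only [primitiveChars, mem_filter, mem_univ, true_and] at hχ
  have h := gaussSum_mul_gaussSum_inv hχ.1
  rw [hχ.2] at h
  have hN : (N : ℂ) ≠ 0 := NeZero.ne _
  have hε : ((ε : ℤ) : ℂ) * ((ε : ℤ) : ℂ) = 1 := by
    rcases Int.units_eq_one_or ε with rfl | rfl <;> simp
  have hε0 : ((ε : ℤ) : ℂ) ≠ 0 := fun h0 => by simp [h0] at hε
  have hτ : gaussSum χ stdAddChar ≠ 0 := fun h0 => by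
    rw [h0, zero_mul] at h
    exact mul_ne_zero hε0 hN h.symm
  rw [tau_eq_gaussSum, div_eq_iff hτ]
  calc χ a = ((ε : ℤ) : ℂ) * ((ε : ℤ) : ℂ) * N / N * χ a := by rw [hε]; field_simp
    _ = ((ε : ℤ) : ℂ) / N * (((ε : ℤ) : ℂ) * N) * χ a := by ring
    _ = _ := by rw [← h]; ring

open Classical in
theorem norm_modulusTerm_sub_sum_le {N : ℕ} [NeZero N] (ε : ℤˣ) (p : ℕ) :
    ‖modulusTerm ε p N - ((ε : ℤ) : ℂ) / N *
      ∑ χ : DirichletCharacter ℂ N with χ (-1) = ((ε : ℤ) : ℂ),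
        gaussSum χ⁻¹ stdAddChar * χ (p : ZMod N)‖ ≤ Real.sqrt N / N := by
  set F : DirichletCharacter ℂ N → ℂ := fun χ => gaussSum χ⁻¹ stdAddChar * χ (p : ZMod N) with hF
  have h1 : modulusTerm ε p N = ((ε : ℤ) : ℂ) / N *
      (∑ χ ∈ primitiveChars ε N, F χ + ∑ χ ∈ imprimitiveChars ε N, F χ) := by
    rw [modulusTerm, sum_congr rfl fun χ hχ => primitive_term_eq ε hχ _, ← mul_sum]
    simp only [tau_eq_gaussSum, MulChar.star_eq_inv, hF]
    ring
  -- The two families exhaust the parity class except for the principal character, missing only when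
  -- it has parity `ε` and is imprimitive.
  have h2 : (∑ χ ∈ primitiveChars ε N, F χ + ∑ χ ∈ imprimitiveChars ε N, F χ) -
      ∑ χ : DirichletCharacter ℂ N with χ (-1) = ((ε : ℤ) : ℂ), F χ =
      -(if (1 : DirichletCharacter ℂ N) (-1) = ((ε : ℤ) : ℂ) ∧
        ¬ (1 : DirichletCharacter ℂ N).IsPrimitive then F 1 else 0) := by
    simp only [primitiveChars, imprimitiveChars]
    rw [sum_filter, sum_filter, sum_filter, ← sum_add_distrib, ← sum_sub_distrib,
      sum_eq_single 1]
    · by_cases h : (1 : DirichletCharacter ℂ N) (-1) = ((ε : ℤ) : ℂ) <;>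
        by_cases h' : (1 : DirichletCharacter ℂ N).IsPrimitive <;> simp [h, h']
    · intro χ _ hχ
      by_cases h : χ (-1) = ((ε : ℤ) : ℂ) <;> by_cases h' : χ.IsPrimitive <;> simp [h, h', hχ]
    · simp
  have h3 : ‖F 1‖ ≤ Real.sqrt N := by
    rw [hF]
    simp only [inv_one, norm_mul]
    exact (mul_le_of_le_one_right (norm_nonneg _) (DirichletCharacter.norm_le_one _ _)).trans
      (norm_gaussSum_one_le N)
  have hε : ‖((ε : ℤ) : ℂ)‖ = 1 := by rcases Int.units_eq_one_or ε with rfl | rfl <;> simp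
  rw [h1, ← mul_sub, h2, norm_mul, norm_div, hε, norm_neg, Complex.norm_natCast,
    one_div_mul_eq_div]
  refine div_le_div_of_nonneg_right ?_ N.cast_nonneg
  split_ifs
  · exact h3
  · simp

theorem norm_mainTerm_le (ε : ℤˣ) (p N : ℕ) : ‖mainTerm ε p N‖ ≤ 1 := by
  have hε : ‖((ε : ℤ) : ℂ)‖ = 1 := by rcases Int.units_eq_one_or ε with rfl | rfl <;> simp
  have hre : (2 * Real.pi * Complex.I * (p : ℂ) / N) = ((2 * Real.pi * p / N : ℝ) : ℂ) *
      Complex.I := by push_cast; ring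
  have h1 : ‖Complex.exp (2 * Real.pi * Complex.I * p / N) +
      ((ε : ℤ) : ℂ) * Complex.exp (-(2 * Real.pi * Complex.I * p / N))‖ ≤ 2 := by
    refine (norm_add_le _ _).trans ?_
    rw [norm_mul, hε, hre, ← neg_mul, ← Complex.ofReal_neg, Complex.norm_exp_ofReal_mul_I,
      Complex.norm_exp_ofReal_mul_I]
    norm_num
  rw [mainTerm, norm_mul, norm_mul, norm_div, norm_div, hε, Complex.norm_natCast,
    Complex.norm_natCast, Complex.norm_two]
  have h2 : (N.totient : ℝ) ≤ N := by exact_mod_cast Nat.totient_le N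
  calc 1 / (N : ℝ) * (N.totient / 2 * _) ≤ 1 / (N : ℝ) * (N / 2 * 2) := by gcongr
    _ = (N : ℝ) / N := by ring
    _ ≤ 1 := div_self_le_one _

/-- If `p ∣ N` every `χ(p)` vanishes, so the whole main term, of norm at most `1`, is error.
Otherwise only the principal character is. -/
theorem norm_modulusTerm_sub_mainTerm_le (ε : ℤˣ) {p N : ℕ} (hp : p.Prime) (hN : N ≠ 0) :
    ‖modulusTerm ε p N - mainTerm ε p N‖ ≤ Real.sqrt N / N + if p ∣ N then 1 else 0 := by
  have : NeZero N := ⟨hN⟩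
  split_ifs with h
  · have hnu : ¬ IsUnit (p : ZMod N) := by
      rw [ZMod.isUnit_prime_iff_not_dvd hp]
      exact not_not.mpr h
    have h0 : modulusTerm ε p N = 0 := by
      simp [modulusTerm, MulChar.map_nonunit _ hnu]
    rw [h0, zero_sub, norm_neg]
    have : 0 ≤ Real.sqrt N / N := by positivity
    linarith [norm_mainTerm_le ε p N]
  · have hu : IsUnit (p : ZMod N) := ZMod.isUnit_prime_of_not_dvd hp h
    have he : (stdAddChar (p : ZMod N) : ℂ) = Complex.exp (2 * Real.pi * Complex.I * p / N) := by
      rw [ZMod.stdAddChar_apply, ZMod.toCircle_natCast]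
    have hm : mainTerm ε p N = ((ε : ℤ) : ℂ) / N * (N.totient / 2 *
        (stdAddChar (p : ZMod N) + ((ε : ℤ) : ℂ) * stdAddChar (-(p : ZMod N)))) := by
      rw [AddChar.map_neg_eq_inv, he, ← Complex.exp_neg, mainTerm]
    rw [hm, ← sum_parity_gaussSum_inv_mul ε hu, add_zero]
    exact norm_modulusTerm_sub_sum_le ε p

theorem mainTerm_one (p N : ℕ) : mainTerm 1 p N =
    (((N.totient : ℝ) / N * Real.cos (2 * Real.pi * p / N) : ℝ) : ℂ) := by
  have hre : (2 * Real.pi * Complex.I * (p : ℂ) / N) = (2 * Real.pi * p / N) *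
      Complex.I := by ring
  rw [mainTerm, hre]
  push_cast
  rw [Complex.cos, neg_mul]
  simp
  ring

theorem mainTerm_neg_one (p N : ℕ) : mainTerm (-1) p N =
    -Complex.I * (((N.totient : ℝ) / N * Real.sin (2 * Real.pi * p / N) : ℝ) : ℂ) := by
  have hre : (2 * Real.pi * Complex.I * (p : ℂ) / N) = (2 * Real.pi * p / N) *
      Complex.I := by ring
  rw [mainTerm, hre]
  push_cast
  rw [Complex.sin, neg_mul]
  simp
  linear_combination (-(N.totient : ℂ) / N / 2 *
    (Complex.exp (2 * Real.pi * p / N * Complex.I) -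
      Complex.exp (-(2 * Real.pi * p / N * Complex.I)))) * Complex.I_sq

end Murmuration

/-! ### Averaging over moduli. -/

namespace Murmuration
open Filter Topology

theorem T_eq (ε : ℤˣ) (y X c : ℝ) :
    T ε y X c = 1 / (X : ℂ) * ∑ N ∈ conductors X c, modulusTerm ε (primeCeil (y * X)) N := by
  simp only [T, Q, E, modulusTerm, Finset.sum_add_distrib, ← Finset.mul_sum]
  ring

theorem card_Icc_le {X c : ℝ} (hX : 1 ≤ X) (hc : 1 < c) :
    ((Finset.Icc ⌈X⌉₊ ⌊c * X⌋₊).card : ℝ) ≤ c * X := by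
  have h1 : 1 ≤ ⌈X⌉₊ := Nat.one_le_ceil_iff.mpr (by linarith)
  refine le_trans ?_ (Nat.floor_le (by positivity : 0 ≤ c * X))
  rw [Nat.card_Icc]
  exact_mod_cast (by omega : ⌊c * X⌋₊ + 1 - ⌈X⌉₊ ≤ ⌊c * X⌋₊)

theorem sum_conductors_dvd_le {X c y : ℝ} (hX : 1 ≤ X) (hc : 1 < c) (hy : 0 < y) :
    ∑ N ∈ conductors X c, (if primeCeil (y * X) ∣ N then (1 : ℝ) else 0) ≤ c / y := by
  set p := primeCeil (y * X)
  have hp : y * X ≤ p := (primeCeil_spec (y * X)).2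
  have hX0 : 0 < X := by linarith
  have hyX : 0 < y * X := by positivity
  calc _ ≤ ∑ N ∈ Finset.Ioc 0 ⌊c * X⌋₊, (if p ∣ N then (1 : ℝ) else 0) := by
        refine Finset.sum_le_sum_of_subset_of_nonneg (fun N hN => ?_)
          fun _ _ _ => by split_ifs <;> norm_num
        simp only [conductors, Finset.mem_filter, Finset.mem_Icc] at hN
        have h1 : 1 ≤ ⌈X⌉₊ := Nat.one_le_ceil_iff.mpr hX0
        exact Finset.mem_Ioc.mpr ⟨by omega, hN.1.2⟩
    _ = (⌊c * X⌋₊ / p : ℕ) := sum_ite_dvd _ _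
    _ ≤ (⌊c * X⌋₊ : ℝ) / p := Nat.cast_div_le
    _ ≤ (c * X) / (y * X) := by
        gcongr
        exact Nat.floor_le (by positivity)
    _ = c / y := by field_simp

/-- There are at most `cX` moduli, each with error at most `X^(-1/2)`. In addition at most `c/y` of
them are divisible by the prime, because it is at least `yX`. Both totals are `o(X)`. -/
theorem tendsto_T_sub_mainTerm (ε : ℤˣ) {c y : ℝ} (hc : 1 < c) (hy : 0 < y) :
    Tendsto (fun X : ℝ => T ε y X c -
      1 / (X : ℂ) * ∑ N ∈ conductors X c, mainTerm ε (primeCeil (y * X)) N) atTop (𝓝 0) := by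
  have hlim : Tendsto (fun X : ℝ => c / Real.sqrt X + c / y / X) atTop (𝓝 0) := by
    simpa using (Real.tendsto_sqrt_atTop.const_div_atTop c).add (tendsto_id.const_div_atTop (c / y))
  refine squeeze_zero_norm' ?_ hlim
  filter_upwards [eventually_ge_atTop 1] with X hX
  have hX0 : 0 < X := by linarith
  rw [T_eq, ← mul_sub, ← Finset.sum_sub_distrib, norm_mul, norm_div, norm_one, Complex.norm_real,
    Real.norm_of_nonneg hX0.le, one_div_mul_eq_div, div_le_iff₀ hX0]
  have hbd : ∀ N ∈ conductors X c, ‖modulusTerm ε (primeCeil (y * X)) N -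
      mainTerm ε (primeCeil (y * X)) N‖ ≤
        1 / Real.sqrt X + if primeCeil (y * X) ∣ N then (1 : ℝ) else 0 := by
    intro N hN
    have hXN : X ≤ N := ((mem_conductors hX0 hc N).mp hN).1.1
    have hN0 : N ≠ 0 := by
      rintro rfl
      rw [Nat.cast_zero] at hXN
      linarith
    refine (norm_modulusTerm_sub_mainTerm_le ε (primeCeil_spec (y * X)).1 hN0).trans ?_
    rw [Real.sqrt_div_self']
    gcongr
  have hcard : ((conductors X c).card : ℝ) ≤ c * X :=
    (Nat.cast_le.mpr (Finset.card_filter_le _ _)).trans (card_Icc_le hX hc)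
  have hsq : 0 < Real.sqrt X := Real.sqrt_pos.mpr hX0
  calc _ ≤ _ := norm_sum_le_of_le _ hbd
    _ = (conductors X c).card * (1 / Real.sqrt X) +
        ∑ N ∈ conductors X c, (if primeCeil (y * X) ∣ N then (1 : ℝ) else 0) := by
        rw [Finset.sum_add_distrib, Finset.sum_const, nsmul_eq_mul]
    _ ≤ c * X * (1 / Real.sqrt X) + c / y := by
        gcongr
        exact sum_conductors_dvd_le hX hc hy
    _ = _ := by field_simp

/-- Applied to cosine and sine. As `g` is 1-Lipschitz, replacing `p/X` by `y` changes each summand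
by at most `2π|p/X - y|`, which tends to `0`. The weighted mean value then applies at `N/X`. -/
theorem tendsto_totient_sum {g g' : ℝ → ℝ} (hg : ∀ x, HasDerivAt g (g' x) x)
    (hg'c : Continuous g') (hgb : ∀ x, |g x| ≤ 1) (hg'b : ∀ x, |g' x| ≤ 1)
    {c y : ℝ} (hc : 1 < c) (hy : 0 < y) :
    Tendsto (fun X : ℝ => 1 / X * ∑ N ∈ conductors X c, (N.totient : ℝ) / N *
        g (2 * Real.pi * primeCeil (y * X) / N)) atTop
      (𝓝 (5 / Real.pi ^ 2 * ∫ x in (1 : ℝ)..c, g (2 * Real.pi * y / x))) := by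
  have hlip (a b : ℝ) : |g a - g b| ≤ |a - b| := by
    have := convex_univ.norm_image_sub_le_of_norm_hasDerivWithin_le (f := g) (f' := g') (C := 1)
      (fun x _ => (hg x).hasDerivWithinAt) (fun x _ => hg'b x) (Set.mem_univ b) (Set.mem_univ a)
    simpa using this
  have hmain := tendsto_weighted_mean totientWeight_nonneg totientWeight_le_one
    tendsto_sum_totientWeight hc (f := fun x => g (2 * Real.pi * y / x))
    (f' := fun x => g' (2 * Real.pi * y / x) * (-(2 * Real.pi * y) / x ^ 2))
    (fun x hx => by
      have hx0 : x ≠ 0 := by linarith [hx.1]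
      have h1 : HasDerivAt (fun x : ℝ => 2 * Real.pi * y / x) (-(2 * Real.pi * y) / x ^ 2) x := by
        exact ((hasDerivAt_const x (2 * Real.pi * y)).div (hasDerivAt_id x) hx0).congr_deriv
          (by simp)
      exact (hg _).comp x h1)
    (by
      have hx0 : ∀ x ∈ Set.Icc 1 c, x ≠ 0 := fun x hx => by linarith [hx.1]
      refine ContinuousOn.mul (hg'c.comp_continuousOn ?_) ?_
      · exact continuousOn_const.div continuousOn_id hx0
      · exact continuousOn_const.div (by fun_prop) fun x hx => pow_ne_zero 2 (hx0 x hx))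
  have herr : Tendsto (fun X : ℝ => 1 / X + c * (2 * Real.pi *
      |(primeCeil (y * X) : ℝ) / X - y|)) atTop (𝓝 0) := by
    have h2 := (((tendsto_primeCeil_div hy).sub_const y).abs.const_mul (2 * Real.pi)).const_mul c
    simpa using (tendsto_id.const_div_atTop (1 : ℝ)).add h2
  have hdiff : Tendsto (fun X : ℝ => 1 / X * ∑ N ∈ conductors X c, (N.totient : ℝ) / N *
        g (2 * Real.pi * primeCeil (y * X) / N) -
      (∑ k ∈ Finset.Ioc ⌊X⌋₊ ⌊c * X⌋₊, g (2 * Real.pi * y / (k / X)) * totientWeight k) / X)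
      atTop (𝓝 0) := by
    refine squeeze_zero_norm' ?_ herr
    filter_upwards [eventually_ge_atTop 1] with X hX
    have hX0 : 0 < X := by linarith
    set p := primeCeil (y * X) with hp
    have hw (k : ℕ) : |totientWeight k| ≤ 1 := by
      rw [abs_of_nonneg (totientWeight_nonneg k)]
      exact totientWeight_le_one k
    have e1 : ∑ N ∈ conductors X c, (N.totient : ℝ) / N * g (2 * Real.pi * p / N) =
        ∑ N ∈ Finset.Icc ⌈X⌉₊ ⌊c * X⌋₊, totientWeight N * g (2 * Real.pi * p / N) := by
      rw [conductors, Finset.sum_filter]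
      refine Finset.sum_congr rfl fun N _ => ?_
      unfold totientWeight
      by_cases h : N ≡ 2 [MOD 4] <;> simp [h]
    have hsub : Finset.Ioc ⌊X⌋₊ ⌊c * X⌋₊ ⊆ Finset.Icc ⌈X⌉₊ ⌊c * X⌋₊ := fun N hN => by
      rw [Finset.mem_Ioc] at hN
      rw [Finset.mem_Icc]
      exact ⟨(Nat.ceil_le_floor_add_one X).trans hN.1, hN.2⟩
    -- Abel summation omits the left endpoint, which belongs to the range of moduli when `X` is an
    -- integer. It costs at most one term of size `1`.
    have hsd : Finset.Icc ⌈X⌉₊ ⌊c * X⌋₊ \ Finset.Ioc ⌊X⌋₊ ⌊c * X⌋₊ ⊆ {⌊X⌋₊} := fun N hN => by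
      rw [Finset.mem_sdiff, Finset.mem_Icc, Finset.mem_Ioc] at hN
      have h3 : ⌊X⌋₊ ≤ ⌈X⌉₊ := Nat.floor_le_ceil X
      rw [Finset.mem_singleton]
      omega
    have e2 : |∑ N ∈ Finset.Icc ⌈X⌉₊ ⌊c * X⌋₊, totientWeight N * g (2 * Real.pi * y / (N / X)) -
        ∑ k ∈ Finset.Ioc ⌊X⌋₊ ⌊c * X⌋₊, g (2 * Real.pi * y / (k / X)) * totientWeight k| ≤ 1 := by
      rw [← Finset.sum_sdiff hsub]
      simp_rw [mul_comm (g _)]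
      rw [add_sub_cancel_right]
      refine (Finset.abs_sum_le_sum_abs _ _).trans ?_
      refine (Finset.sum_le_sum_of_subset_of_nonneg hsd fun _ _ _ => abs_nonneg _).trans ?_
      rw [Finset.sum_singleton, abs_mul]
      exact mul_le_one₀ (hw _) (abs_nonneg _) (hgb _)
    have e3 : |∑ N ∈ Finset.Icc ⌈X⌉₊ ⌊c * X⌋₊, totientWeight N * g (2 * Real.pi * p / N) -
        ∑ N ∈ Finset.Icc ⌈X⌉₊ ⌊c * X⌋₊, totientWeight N * g (2 * Real.pi * y / (N / X))| ≤
          c * X * (2 * Real.pi * |(p : ℝ) / X - y|) := by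
      rw [← Finset.sum_sub_distrib]
      refine (Finset.abs_sum_le_sum_abs _ _).trans ?_
      refine (Finset.sum_le_card_nsmul _ _ (2 * Real.pi * |(p : ℝ) / X - y|) fun N hN => ?_).trans ?_
      · have hXN : X ≤ N := (Nat.ceil_le).mp (Finset.mem_Icc.mp hN).1
        have hN0 : (0 : ℝ) < N := hX0.trans_le hXN
        rw [← mul_sub, abs_mul]
        refine (mul_le_of_le_one_left (abs_nonneg _) (hw N)).trans ((hlip _ _).trans ?_)
        have : 2 * Real.pi * p / N - 2 * Real.pi * y / (N / X) =
            2 * Real.pi * ((p : ℝ) / X - y) * (X / N) := by field_simp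
        rw [this, abs_mul, abs_mul, abs_of_pos Real.two_pi_pos,
          abs_of_pos (div_pos hX0 hN0)]
        exact mul_le_of_le_one_right (by positivity) ((div_le_one hN0).mpr hXN)
      · rw [nsmul_eq_mul]
        exact mul_le_mul_of_nonneg_right (card_Icc_le hX hc) (by positivity)
    rw [e1, one_div_mul_eq_div, ← sub_div, norm_div, Real.norm_eq_abs, Real.norm_of_nonneg hX0.le,
      div_le_iff₀ hX0]
    refine (abs_sub_le _ _ _).trans ((add_le_add e3 e2).trans_eq ?_)
    field_simp
    ring
  simpa using hdiff.add hmain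

end Murmuration

theorem mainTheorem4 (c y : ℝ) (hc : 1 < c) (hy : 0 < y) :
    Filter.Tendsto (fun X : ℝ => Murmuration.T 1 y X c) Filter.atTop
      (nhds (5 / (Real.pi : ℂ) ^ 2 *
        ((∫ x in (1 : ℝ)..c, Real.cos (2 * Real.pi * y / x) : ℝ) : ℂ))) ∧
    Filter.Tendsto (fun X : ℝ => Murmuration.T (-1) y X c) Filter.atTop
      (nhds (-Complex.I * (5 / (Real.pi : ℂ) ^ 2) *
        ((∫ x in (1 : ℝ)..c, Real.sin (2 * Real.pi * y / x) : ℝ) : ℂ))) := by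
  constructor
  · have h1 := Murmuration.tendsto_totient_sum Real.hasDerivAt_cos (by fun_prop)
      Real.abs_cos_le_one (fun x => by rw [abs_neg]; exact Real.abs_sin_le_one x) hc hy
    have h2 := ((Complex.continuous_ofReal.tendsto _).comp h1)
    have h3 := (Murmuration.tendsto_T_sub_mainTerm 1 hc hy).add h2
    rw [zero_add] at h3
    convert! h3 using 2 with X
    · simp only [Murmuration.mainTerm_one, Function.comp, Complex.ofReal_mul, Complex.ofReal_sum,
        Complex.ofReal_div, Complex.ofReal_one]
      ring
    · push_cast
      rfl
  · have h1 := Murmuration.tendsto_totient_sum Real.hasDerivAt_sin (by fun_prop)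
      Real.abs_sin_le_one Real.abs_cos_le_one hc hy
    have h2 := ((Complex.continuous_ofReal.tendsto _).comp h1).const_mul (-Complex.I)
    have h3 := (Murmuration.tendsto_T_sub_mainTerm (-1) hc hy).add h2
    rw [zero_add] at h3
    convert! h3 using 2 with X
    · simp only [Murmuration.mainTerm_neg_one, Function.comp, Complex.ofReal_mul,
        Complex.ofReal_sum, Complex.ofReal_div, Complex.ofReal_one, ← Finset.mul_sum]
      ring
    · push_cast
      ring
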